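/- \textbf{Setting.} Let $M$ be a connected smooth manifold without boundary, of dimension $n\ge 1$, with a smooth Riemannian metric $g$, geodesic distance $d_g$ and $g$-diameter $\operatorname{diam}_g$. Let $\Delta_d\subseteq\mathbb R^d$ be the convex hull of the origin and of the $d$ canonical unit vectors, taken in this order as vertices number $0,\dots,d$. A \emph{smooth $d$-simplex} is a smooth embedding $\imath_T:\Delta_d\to M$ of the closed reference simplex, with image $T$. A \emph{subsimplex} $S$ of $T$ is a smooth simplex $\imath_S=\imath_T\circ\imath_{I,d}$, where $\imath_{I,d}:\Delta_l\to\Delta_d$ is the affine map that sends the vertices of $\Delta_l$, in increasing order, to the vertices of $\Delta_d$ with index in $I\subseteq\{0,\dots,d\}$, $|I|=l+1$. A \emph{smooth triangulation} $\mathcal T$ of $M$ is a locally finite collection of smooth simplices whose $n$-simplices cover $M$, which contains all subsimplices of its members, and in which the images of any two members are disjoint or intersect in the image of a common subsimplex of both. Put $h_T=\operatorname{diam}_g(T)$ if $T\in\mathcal T$ has positive dimension, and for a vertex $V$ let $h_V$ be the smallest $h_T$ over the simplices $T\in\mathcal T$ of positive dimension that contain $V$. The shape constant $C_1(T)$ is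 the smallest constant $C$ with $\|\nabla\imath_T\|\le C\,h_T$ and $\|\nabla\imath_T^{-1}\|\le C\,h_T^{-1}$ at every point of $T$. Here $\|\cdot\|$ is the pointwise tensor (Hilbert--Schmidt) norm induced by $g$ and the Euclidean metric of $\Delta_d$, and $\nabla\imath_T^{-1}$ is the Jacobian of $\imath_T^{-1}:T\to\Delta_d$. Assume that $C_1(\mathcal T):=\sup_{T\in\mathcal T}C_1(T)$ is finite (this is automatic if $M$ is compact). Let $C_\triangle$ be a real constant such that $h_T\le C_\triangle h_S$ for every $T\in\mathcal T$ and every subsimplex $S$ of $T$ (vertices included). \textbf{Theorem.} There is a smooth function $\mathtt h:M\to\mathbb R$ with $\mathtt h>0$ everywhere such that $$ (1.01\,C_\triangle)^{-1}\,h_T\;\le\;\mathtt h(x)\;\le\;1.01\,C_\triangle\,h_T\qquad\text{for all }T\in\mathcal T\text{ and all }x\in T, $$ $$ \frac{|\mathtt h(x)-\mathtt h(y)|}{d_g(x,y)}\;\le\;1.01\;C_1(\mathcal T)^2\,\Bigl(C_\triangle-\frac1{C_\triangle}\Bigr)\qquad\text{for all }x,y\in M,\ x\ne y. $$ -/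

import Mathlib

open Set Filter Topology Manifold Bundle
open scoped ContDiff

noncomputable section

/-! ## The reference simplex and its faces -/

/-- The reference `d`-simplex `Δ_d ⊆ ℝ^d`: the convex hull of the origin and of the `d` canonical
coordinate vectors, described by inequalities (see `refSimplex_eq_convexHull`). -/
def refSimplex (d : ℕ) : Set (EuclideanSpace ℝ (Fin d)) :=
  {x | (∀ i, 0 ≤ x i) ∧ ∑ i, x i ≤ 1}

/-- The vertices of `Δ_d`: number `0` is the origin, number `i + 1` is the `i`-th unit vector. -/
def refVertex (d : ℕ) : Fin (d + 1) → EuclideanSpace ℝ (Fin d) :=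
  Fin.cons 0 (fun i => EuclideanSpace.single i (1 : ℝ))

/-- Barycentric coordinates with respect to the vertices of `Δ_d`. -/
def baryCoord {d : ℕ} (x : EuclideanSpace ℝ (Fin d)) : Fin (d + 1) → ℝ :=
  Fin.cons (1 - ∑ i, x i) (fun i => x i)

theorem baryCoord_nonneg {d : ℕ} {x : EuclideanSpace ℝ (Fin d)} (hx : x ∈ refSimplex d)
    (j : Fin (d + 1)) : 0 ≤ baryCoord x j := by
  refine Fin.cases ?_ (fun i => ?_) j
  · simpa [baryCoord] using hx.2
  · simpa [baryCoord] using hx.1 i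

theorem sum_baryCoord {d : ℕ} (x : EuclideanSpace ℝ (Fin d)) : ∑ j, baryCoord x j = 1 := by
  simp [baryCoord, Fin.sum_univ_succ]

theorem sum_baryCoord_smul {d : ℕ} (x : EuclideanSpace ℝ (Fin d)) :
    ∑ j, baryCoord x j • refVertex d j = x := by
  ext i
  simp [baryCoord, refVertex, Fin.sum_univ_succ, Pi.single_apply]

theorem refVertex_mem (d : ℕ) (j : Fin (d + 1)) : refVertex d j ∈ refSimplex d := by
  refine Fin.cases ?_ (fun i => ?_) j
  · simp [refVertex, refSimplex]
  · refine ⟨fun k => ?_, ?_⟩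
    · by_cases h : k = i <;> simp [refVertex, h]
    · simp [refVertex]

theorem convex_refSimplex (d : ℕ) : Convex ℝ (refSimplex d) := by
  intro x hx y hy a b ha hb hab
  refine ⟨fun i => ?_, ?_⟩
  · have h1 := mul_nonneg ha (hx.1 i)
    have h2 := mul_nonneg hb (hy.1 i)
    simpa using add_nonneg h1 h2
  · have h1 := mul_le_mul_of_nonneg_left hx.2 ha
    have h2 := mul_le_mul_of_nonneg_left hy.2 hb
    have h3 : ∑ i, (a • x + b • y) i = a * ∑ i, x i + b * ∑ i, y i := by
      simp [Finset.sum_add_distrib, Finset.mul_sum]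
    rw [h3]
    linarith

theorem refSimplex_eq_convexHull (d : ℕ) :
    refSimplex d = convexHull ℝ (range (refVertex d)) := by
  apply Subset.antisymm
  · intro x hx
    rw [← sum_baryCoord_smul x]
    exact (convex_convexHull ℝ _).sum_mem (fun j _ => baryCoord_nonneg hx j) (sum_baryCoord x)
      (fun j _ => subset_convexHull ℝ _ (mem_range_self j))
  · refine convexHull_min ?_ (convex_refSimplex d)
    rintro _ ⟨j, rfl⟩
    exact refVertex_mem d j

/-- A subset of `l + 1` indices of `{0, …, d}` is given by its increasing enumeration `σ`.
`faceMap σ : Δ_l → Δ_d` is the affine map that sends the `j`-th vertex of `Δ_l` to the vertex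
number `σ j` of `Δ_d`. -/
def faceMap {l d : ℕ} (σ : Fin (l + 1) ↪o Fin (d + 1)) (x : refSimplex l) : refSimplex d :=
  ⟨∑ j, baryCoord (x : EuclideanSpace ℝ (Fin l)) j • refVertex d (σ j),
    (convex_refSimplex d).sum_mem (fun j _ => baryCoord_nonneg x.2 j) (sum_baryCoord _)
      (fun j _ => refVertex_mem d (σ j))⟩

/-! ## Smooth simplices and triangulations -/

section Simplices

/-- The extension by a constant of a map on the reference simplex to the whole space. It only
serves to apply notions for maps on vector spaces *within* `Δ_d`. -/
def extendRef {M : Type*} {d : ℕ} (f : refSimplex d → M) (x : EuclideanSpace ℝ (Fin d)) : M :=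
  Function.extend ((↑) : refSimplex d → EuclideanSpace ℝ (Fin d)) f
    (fun _ => f ⟨refVertex d 0, refVertex_mem d 0⟩) x

variable (n : ℕ) (M : Type*) [TopologicalSpace M] [ChartedSpace (EuclideanSpace ℝ (Fin n)) M]

/-- A smooth simplex in the `n`-manifold `M`: a smooth embedding of a reference simplex, that is,
an injective smooth map (topologically an embedding, as the reference simplex is compact) whose
differential is injective at every point of the closed reference simplex. -/
structure SmoothSimplex where
  /-- the dimension -/
  dim : ℕ
  /-- the embedding of the reference simplex -/
  toFun : refSimplex dim → M
  smooth : ContMDiffOn 𝓘(ℝ, EuclideanSpace ℝ (Fin dim)) (𝓡 n) ∞ (extendRef toFun)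
    (refSimplex dim)
  injective : Function.Injective toFun
  immersion : ∀ x ∈ refSimplex dim, Function.Injective
    (mfderivWithin 𝓘(ℝ, EuclideanSpace ℝ (Fin dim)) (𝓡 n) (extendRef toFun) (refSimplex dim) x)

variable {n M}

/-- The image of a smooth simplex. -/
def SmoothSimplex.image (T : SmoothSimplex n M) : Set M := range T.toFun

/-- `S` is a subsimplex of `T`: its embedding is that of `T` composed with a face map. -/
def SmoothSimplex.IsSubsimplex (S T : SmoothSimplex n M) : Prop :=
  ∃ σ : Fin (S.dim + 1) ↪o Fin (T.dim + 1), ∀ x, S.toFun x = T.toFun (faceMap σ x)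

variable (n M)

/-- A smooth triangulation of the `n`-manifold `M`: a locally finite collection of smooth simplices
whose `n`-simplices cover `M`, which contains the subsimplices of its members, and in which
two simplices are disjoint or meet in a common subsimplex. -/
structure SmoothTriangulation where
  /-- the simplices, of all dimensions -/
  simplices : Set (SmoothSimplex n M)
  locallyFinite : LocallyFinite (fun T : simplices => (T : SmoothSimplex n M).image)
  cover : ∀ x : M, ∃ T ∈ simplices, T.dim = n ∧ x ∈ T.image
  subsimplex_mem : ∀ T ∈ simplices, ∀ S : SmoothSimplex n M, S.IsSubsimplex T → S ∈ simplices
  inter : ∀ T₁ ∈ simplices, ∀ T₂ ∈ simplices, T₁.image ∩ T₂.image = ∅ ∨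
    ∃ S : SmoothSimplex n M, S.IsSubsimplex T₁ ∧ S.IsSubsimplex T₂ ∧
      S.image = T₁.image ∩ T₂.image

end Simplices

/-! ## Metric quantities -/

/-- The Hilbert–Schmidt (Frobenius) norm of a linear map between inner product spaces, i.e. its norm
as a tensor. -/
def hsNorm {V W : Type*} [NormedAddCommGroup V] [InnerProductSpace ℝ V] [FiniteDimensional ℝ V]
    [NormedAddCommGroup W] [InnerProductSpace ℝ W] (L : V →ₗ[ℝ] W) : ℝ :=
  √(∑ i, ‖L (stdOrthonormalBasis ℝ V i)‖ ^ 2)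

section Jacobian

variable {n : ℕ} {M : Type*} [TopologicalSpace M] [ChartedSpace (EuclideanSpace ℝ (Fin n)) M]

/-- The Jacobian of the embedding `ι_T : Δ_d → M` at a point of `Δ_d`. -/
def SmoothSimplex.jacobian (T : SmoothSimplex n M) (x : refSimplex T.dim) :
    EuclideanSpace ℝ (Fin T.dim) →ₗ[ℝ]
      TangentSpace (𝓡 n) (extendRef T.toFun (x : EuclideanSpace ℝ (Fin T.dim))) :=
  ((mfderivWithin 𝓘(ℝ, EuclideanSpace ℝ (Fin T.dim)) (𝓡 n) (extendRef T.toFun)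
    (refSimplex T.dim) (x : EuclideanSpace ℝ (Fin T.dim))).comp
    (NormedSpace.fromTangentSpace (𝕜 := ℝ)
      (x : EuclideanSpace ℝ (Fin T.dim))).symm.toContinuousLinearMap).toLinearMap

theorem SmoothSimplex.jacobian_injective (T : SmoothSimplex n M) (x : refSimplex T.dim) :
    Function.Injective (T.jacobian x) :=
  (T.immersion x x.2).comp (NormedSpace.fromTangentSpace (𝕜 := ℝ)
      (x : EuclideanSpace ℝ (Fin T.dim))).symm.injective

/-- The Jacobian of the inverse `ι_T⁻¹ : T → Δ_d` at `ι_T x`: the inverse of the Jacobian of `ι_T`,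
defined on the tangent space of the embedded submanifold `T` at `ι_T x`. -/
def SmoothSimplex.invJacobian (T : SmoothSimplex n M) (x : refSimplex T.dim) :
    LinearMap.range (T.jacobian x) →ₗ[ℝ] EuclideanSpace ℝ (Fin T.dim) :=
  (LinearEquiv.ofInjective (T.jacobian x) (T.jacobian_injective x)).symm.toLinearMap

end Jacobian

section Mesh

variable {n : ℕ} {M : Type*} [MetricSpace M] [ChartedSpace (EuclideanSpace ℝ (Fin n)) M]

/-- The mesh size `h_T`: the diameter of `T` if `T` has positive dimension; for a vertex, the
smallest diameter of a simplex of positive dimension of the triangulation that contains it. -/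
def SmoothTriangulation.meshSize (𝒯 : SmoothTriangulation n M) (T : SmoothSimplex n M) : ℝ :=
  if 0 < T.dim then Metric.diam T.image
  else sInf {r | ∃ T' ∈ 𝒯.simplices, 0 < T'.dim ∧ T.image ⊆ T'.image ∧ r = Metric.diam T'.image}

variable [RiemannianBundle (fun x : M => TangentSpace (𝓡 n) x)]

/-- The shape constant of a simplex `T` of `𝒯`: the smallest constant `C` with
`‖∇ι_T‖ ≤ C h_T` and `‖∇ι_T⁻¹‖ ≤ C h_T⁻¹` everywhere on `T`. -/
def SmoothTriangulation.simplexShapeConst (𝒯 : SmoothTriangulation n M) (T : SmoothSimplex n M) :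
    ℝ :=
  sInf {C | ∀ x : refSimplex T.dim, hsNorm (T.jacobian x) ≤ C * 𝒯.meshSize T ∧
    hsNorm (T.invJacobian x) ≤ C * (𝒯.meshSize T)⁻¹}

/-- The set of the shape constants of the simplices of a triangulation. -/
def SmoothTriangulation.shapeConsts (𝒯 : SmoothTriangulation n M) : Set ℝ :=
  𝒯.simplexShapeConst '' 𝒯.simplices

/-- The shape constant of a triangulation: the largest of those of its simplices (if these are
bounded, which is automatic for a compact manifold). -/
def SmoothTriangulation.shapeConst (𝒯 : SmoothTriangulation n M) : ℝ :=
  sSup 𝒯.shapeConsts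

end Mesh

end

/-! Give every vertex the smallest diameter of the positive-dimensional simplices containing it, and
interpolate these values linearly in barycentric coordinates. Simplices meet in common faces, so the
interpolants glue to a function f on M (`exists_interpolation`). On T the vertex values lie between
h_T / C and h_T, where C is `Ctri`, hence so does f.

In reference coordinates on a d-simplex the gradient of f has d components, each a difference of two
vertex values, so its norm is at most √d h_T (1 - 1/C). Passing to M costs ‖∇ι_T⁻¹‖ ≤ C₁ / h_T.
Moreover √d ≤ C₁, because d is the trace of ∇ι_T⁻¹ ∇ι_T and hence at most ‖∇ι_T‖ ‖∇ι_T⁻¹‖ ≤ C₁²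
(`finrank_le_hsNorm_mul_hsNorm`). So the pointwise Lipschitz constant of f is at most C₁² (1 - 1/C),
and integration along almost minimizing curves makes this bound global (`abs_sub_le_of_eventually`).

It remains to smooth f with a small relative error and an arbitrarily small loss in the Lipschitz
constant (`exists_contMDiff_lipschitz_near`): mollify in almost isometric charts and glue by a
partition of unity, with local errors small enough to offset the slopes of the cutoffs. For C > 1
there is room, since 1 - 1/C < C - 1/C; for C = 1 the function f is already constant. -/

section

/-! ### Almost isometric charts -/

variable {n : ℕ} {M : Type*}

/-- At any point, the trivialization of the tangent bundle can be corrected by a linear isomorphism so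
that it is an isometry at the point and almost an isometry nearby. -/
theorem exists_isometric_frame [TopologicalSpace M]
    [ChartedSpace (EuclideanSpace ℝ (Fin n)) M] [IsManifold (𝓡 n) 1 M]
    [RiemannianBundle (fun x : M => TangentSpace (𝓡 n) x)]
    [IsContinuousRiemannianBundle (EuclideanSpace ℝ (Fin n))
      (fun x : M => TangentSpace (𝓡 n) x)] (p : M) :
    ∃ L : EuclideanSpace ℝ (Fin n) ≃L[ℝ] EuclideanSpace ℝ (Fin n),
      (∀ v : TangentSpace (𝓡 n) p, ‖L ((trivializationAt (EuclideanSpace ℝ (Fin n))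
        (TangentSpace (𝓡 n)) p).continuousLinearMapAt ℝ p v)‖ = ‖v‖) ∧
      ∀ r : ℝ, 1 < r → ∀ᶠ y in 𝓝 p,
        (∀ v : TangentSpace (𝓡 n) y, ‖L ((trivializationAt (EuclideanSpace ℝ (Fin n))
          (TangentSpace (𝓡 n)) p).continuousLinearMapAt ℝ y v)‖ ≤ r * ‖v‖) ∧
        (∀ w, ‖(trivializationAt (EuclideanSpace ℝ (Fin n))
          (TangentSpace (𝓡 n)) p).symmL ℝ y w‖ ≤ r * ‖L w‖) := by
  have hp : p ∈ (trivializationAt (EuclideanSpace ℝ (Fin n))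
      (TangentSpace (𝓡 n) (M := M)) p).baseSet := FiberBundle.mem_baseSet_trivializationAt' p
  let e := (trivializationAt (EuclideanSpace ℝ (Fin n))
      (TangentSpace (𝓡 n) (M := M)) p).continuousLinearEquivAt ℝ p hp
  have : FiniteDimensional ℝ (TangentSpace (𝓡 n) p) :=
    LinearEquiv.finiteDimensional e.symm.toLinearEquiv
  have hd : Module.finrank ℝ (TangentSpace (𝓡 n) p) = n := by
    rw [e.toLinearEquiv.finrank_eq]; simp
  let b := (stdOrthonormalBasis ℝ (TangentSpace (𝓡 n) p)).reindex (finCongr hd)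
  have he : ∀ w, (trivializationAt (EuclideanSpace ℝ (Fin n))
        (TangentSpace (𝓡 n)) p).symmL ℝ p w = e.symm w := by
    intro w
    rw [← Trivialization.symm_continuousLinearEquivAt_eq _ hp]
  have he' : ∀ w, (trivializationAt (EuclideanSpace ℝ (Fin n))
        (TangentSpace (𝓡 n)) p).continuousLinearMapAt ℝ p w = e w := by
    intro w
    simp [e, Trivialization.coe_continuousLinearEquivAt_eq _ hp]
  -- Composed with the trivialization at `p`, this is the orthonormal coordinate map `b.repr`.
  refine ⟨e.symm.trans b.repr.toContinuousLinearEquiv, ?_, ?_⟩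
  · intro v
    rw [he']
    simp
  · intro r hr
    filter_upwards [eventually_norm_symmL_trivializationAt_self_comp_lt (EuclideanSpace ℝ (Fin n))
        (fun x : M => TangentSpace (𝓡 n) x) p hr,
      eventually_norm_symmL_trivializationAt_comp_self_lt (EuclideanSpace ℝ (Fin n))
        (fun x : M => TangentSpace (𝓡 n) x) p hr] with y h1 h2
    constructor
    · intro v
      have := ContinuousLinearMap.le_of_opNorm_le _ h1.le v
      rw [ContinuousLinearMap.comp_apply, he] at this
      simpa using this
    · intro w
      have := ContinuousLinearMap.le_of_opNorm_le _ h2.le (e.symm w)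
      rw [ContinuousLinearMap.comp_apply, he'] at this
      simpa using this

theorem norm_mfderiv_extChartAt_le [TopologicalSpace M]
    [ChartedSpace (EuclideanSpace ℝ (Fin n)) M] [IsManifold (𝓡 n) 1 M]
    [RiemannianBundle (fun x : M => TangentSpace (𝓡 n) x)] {p y : M}
    (hy : y ∈ (chartAt (EuclideanSpace ℝ (Fin n)) p).source)
    {L : EuclideanSpace ℝ (Fin n) ≃L[ℝ] EuclideanSpace ℝ (Fin n)} {r : ℝ}
    (h : ∀ v : TangentSpace (𝓡 n) y, ‖L ((trivializationAt (EuclideanSpace ℝ (Fin n))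
          (TangentSpace (𝓡 n)) p).continuousLinearMapAt ℝ y v)‖ ≤ r * ‖v‖)
    (v : TangentSpace (𝓡 n) y) :
    ‖L (mfderiv (𝓡 n) 𝓘(ℝ, EuclideanSpace ℝ (Fin n)) (extChartAt (𝓡 n) p) y v)‖ ≤ r * ‖v‖ := by
  rw [← TangentBundle.continuousLinearMapAt_trivializationAt hy]
  exact h v

theorem norm_mfderivWithin_extChartAt_symm_le [TopologicalSpace M]
    [ChartedSpace (EuclideanSpace ℝ (Fin n)) M] [IsManifold (𝓡 n) 1 M]
    [RiemannianBundle (fun x : M => TangentSpace (𝓡 n) x)] {p : M}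
    {z : EuclideanSpace ℝ (Fin n)} (hz : z ∈ (extChartAt (𝓡 n) p).target)
    {L : EuclideanSpace ℝ (Fin n) ≃L[ℝ] EuclideanSpace ℝ (Fin n)} {r : ℝ}
    (h : ∀ w, ‖(trivializationAt (EuclideanSpace ℝ (Fin n))
          (TangentSpace (𝓡 n)) p).symmL ℝ ((extChartAt (𝓡 n) p).symm z) w‖ ≤ r * ‖L w‖)
    (w : EuclideanSpace ℝ (Fin n)) :
    ‖mfderivWithin 𝓘(ℝ, EuclideanSpace ℝ (Fin n)) (𝓡 n) (extChartAt (𝓡 n) p).symm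
      (range (𝓡 n)) z w‖ ≤ r * ‖L w‖ := by
  have hy : (extChartAt (𝓡 n) p).symm z ∈ (chartAt (EuclideanSpace ℝ (Fin n)) p).source := by
    rw [← extChartAt_source (𝓡 n)]; exact (extChartAt (𝓡 n) p).map_target hz
  have := h w
  rw [TangentBundle.symmL_trivializationAt hy] at this
  rw [(extChartAt (𝓡 n) p).right_inv hz] at this
  exact this

/-- The Euclidean displacement is at most the integral of the speed of the image curve, and the
chart derivative multiplies speeds by at most `r`. -/
theorem enorm_extChartAt_comp_sub_le [TopologicalSpace M]
    [ChartedSpace (EuclideanSpace ℝ (Fin n)) M] [IsManifold (𝓡 n) 1 M]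
    [RiemannianBundle (fun x : M => TangentSpace (𝓡 n) x)] {p : M}
    {L : EuclideanSpace ℝ (Fin n) ≃L[ℝ] EuclideanSpace ℝ (Fin n)} {r : ℝ} (hr : 0 ≤ r)
    {γ : ℝ → M} (hγ : ContMDiff 𝓘(ℝ, ℝ) (𝓡 n) 1 γ)
    (h : ∀ t ∈ Icc (0 : ℝ) 1, γ t ∈ (chartAt (EuclideanSpace ℝ (Fin n)) p).source ∧
      ∀ v : TangentSpace (𝓡 n) (γ t),
        ‖L (mfderiv (𝓡 n) 𝓘(ℝ, EuclideanSpace ℝ (Fin n)) (extChartAt (𝓡 n) p) (γ t) v)‖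
          ≤ r * ‖v‖) :
    ‖L (extChartAt (𝓡 n) p (γ 1)) - L (extChartAt (𝓡 n) p (γ 0))‖ₑ
      ≤ ENNReal.ofReal r * pathELength (𝓡 n) γ 0 1 := by
  set f : ℝ → EuclideanSpace ℝ (Fin n) := fun t => L (extChartAt (𝓡 n) p (γ t)) with hf
  have hC : ContMDiffOn 𝓘(ℝ, ℝ) 𝓘(ℝ, EuclideanSpace ℝ (Fin n)) 1
      (fun t => extChartAt (𝓡 n) p (γ t)) (Icc 0 1) :=
    (contMDiffOn_extChartAt (n := 1)).comp (t := (chartAt (EuclideanSpace ℝ (Fin n)) p).source)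
      hγ.contMDiffOn (fun t ht => (h t ht).1)
  have hfC : ContDiffOn ℝ 1 f (Icc 0 1) :=
    L.contDiff.comp_contDiffOn (contMDiffOn_iff_contDiffOn.1 hC)
  have hd : ∀ t ∈ Icc (0 : ℝ) 1, HasDerivAt f
      (L (mfderiv (𝓡 n) 𝓘(ℝ, EuclideanSpace ℝ (Fin n)) (extChartAt (𝓡 n) p) (γ t)
        (mfderiv 𝓘(ℝ, ℝ) (𝓡 n) γ t 1))) t := by
    intro t ht
    have h1 : HasMFDerivAt 𝓘(ℝ, ℝ) 𝓘(ℝ, EuclideanSpace ℝ (Fin n))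
        (extChartAt (𝓡 n) p ∘ γ) t _ := HasMFDerivAt.comp t
      (mdifferentiableAt_extChartAt (I := 𝓡 n) (h t ht).1).hasMFDerivAt
      (hγ.mdifferentiable one_ne_zero t).hasMFDerivAt
    have h2 := h1.hasFDerivAt
    exact (L.hasFDerivAt.comp t h2).hasDerivAt
  refine (enorm_sub_le_lintegral_deriv_of_contDiffOn_Icc hfC zero_le_one).trans ?_
  rw [pathELength_eq_lintegral_mfderiv_Icc, ← MeasureTheory.lintegral_const_mul' _ _
    ENNReal.ofReal_ne_top]
  refine MeasureTheory.setLIntegral_mono' measurableSet_Icc fun t ht => ?_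
  rw [(hd t ht).deriv, ← ofReal_norm, ← ofReal_norm, ← ENNReal.ofReal_mul hr]
  exact ENNReal.ofReal_le_ofReal ((h t ht).2 _)

/-- The straight segment, carried back to the manifold, competes in the infimum defining the
distance, and its speed is at most `r * ‖b - a‖`. -/
theorem riemannianEDist_extChartAt_symm_le [TopologicalSpace M]
    [ChartedSpace (EuclideanSpace ℝ (Fin n)) M] [IsManifold (𝓡 n) 1 M]
    [RiemannianBundle (fun x : M => TangentSpace (𝓡 n) x)] {p : M}
    {L : EuclideanSpace ℝ (Fin n) ≃L[ℝ] EuclideanSpace ℝ (Fin n)} {r : ℝ}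
    {a b : EuclideanSpace ℝ (Fin n)}
    (h : ∀ z ∈ segment ℝ a b, L.symm z ∈ (extChartAt (𝓡 n) p).target ∧
      ∀ w, ‖mfderivWithin 𝓘(ℝ, EuclideanSpace ℝ (Fin n)) (𝓡 n) (extChartAt (𝓡 n) p).symm
        (range (𝓡 n)) (L.symm z) w‖ ≤ r * ‖L w‖) :
    riemannianEDist (𝓡 n) ((extChartAt (𝓡 n) p).symm (L.symm a))
      ((extChartAt (𝓡 n) p).symm (L.symm b)) ≤ ENNReal.ofReal (r * ‖b - a‖) := by
  set η : ℝ → EuclideanSpace ℝ (Fin n) := fun t => L.symm (AffineMap.lineMap a b t) with hη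
  have hl : ContDiff ℝ 1 (AffineMap.lineMap a b : ℝ → EuclideanSpace ℝ (Fin n)) :=
    (ContinuousAffineMap.lineMap (R := ℝ) a b).contDiff
  have hηC : ContDiff ℝ 1 η := L.symm.contDiff.comp hl
  have hηd : ∀ t, HasDerivAt η (L.symm (b - a)) t := fun t =>
    (L.symm.hasFDerivAt.comp_hasDerivAt t AffineMap.hasDerivAt_lineMap)
  have hseg : ∀ t ∈ Icc (0 : ℝ) 1, AffineMap.lineMap a b t ∈ segment ℝ a b := fun t ht => by
    rw [segment_eq_image_lineMap]; exact mem_image_of_mem _ ht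
  have hmaps : MapsTo η (Icc 0 1) (extChartAt (𝓡 n) p).target := fun t ht => (h _ (hseg t ht)).1
  have hsm : ContMDiffOn 𝓘(ℝ, ℝ) 𝓘(ℝ, EuclideanSpace ℝ (Fin n)) 1 η (Icc 0 1) :=
    hηC.contMDiff.contMDiffOn
  refine (riemannianEDist_le_pathELength (γ := (extChartAt (𝓡 n) p).symm ∘ η) (a := 0) (b := 1)
    ((contMDiffOn_extChartAt_symm p).comp hsm hmaps) (by simp [η]) (by simp [η])
    zero_le_one).trans ?_
  rw [pathELength_eq_lintegral_mfderivWithin_Icc]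
  have hle : ∀ t ∈ Icc (0 : ℝ) 1, ‖mfderivWithin 𝓘(ℝ, ℝ) (𝓡 n)
      ((extChartAt (𝓡 n) p).symm ∘ η) (Icc 0 1) t 1‖ₑ ≤ ENNReal.ofReal (r * ‖b - a‖) := by
    intro t ht
    have hc : mfderivWithin 𝓘(ℝ, ℝ) (𝓡 n) ((extChartAt (𝓡 n) p).symm ∘ η) (Icc 0 1) t =
        (mfderivWithin 𝓘(ℝ, EuclideanSpace ℝ (Fin n)) (𝓡 n) (extChartAt (𝓡 n) p).symm
          (range (𝓡 n)) (η t)).comp (mfderivWithin 𝓘(ℝ, ℝ) 𝓘(ℝ, EuclideanSpace ℝ (Fin n)) η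
            (Icc 0 1) t) := by
      apply mfderivWithin_comp
      · exact mdifferentiableWithinAt_extChartAt_symm (hmaps ht)
      · exact hsm.mdifferentiableOn one_ne_zero t ht
      · exact hmaps.mono_right (extChartAt_target_subset_range p)
      · rw [uniqueMDiffWithinAt_iff_uniqueDiffWithinAt]
        exact uniqueDiffOn_Icc zero_lt_one t ht
    have hd : mfderivWithin 𝓘(ℝ, ℝ) 𝓘(ℝ, EuclideanSpace ℝ (Fin n)) η (Icc 0 1) t 1
        = L.symm (b - a) := by
      rw [mfderivWithin_eq_fderivWithin]
      have := ((hηd t).hasDerivWithinAt (s := Icc 0 1)).derivWithin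
        (uniqueDiffOn_Icc zero_lt_one t ht)
      rw [← this]; exact fderivWithin_derivWithin
    rw [hc, ← ofReal_norm]
    refine ENNReal.ofReal_le_ofReal ?_
    have h2 := (h _ (hseg t ht)).2 (L.symm (b - a))
    rw [L.apply_symm_apply] at h2
    rw [ContinuousLinearMap.comp_apply, hd]
    exact h2
  refine (MeasureTheory.setLIntegral_mono' measurableSet_Icc hle).trans ?_
  simp

/-- At any point, the preferred chart can be corrected by a linear isomorphism so that its derivative
there is an isometry, and so that it is almost an isometry for the Riemannian distance nearby. -/
theorem exists_almost_isometric_chart [MetricSpace M]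
    [ChartedSpace (EuclideanSpace ℝ (Fin n)) M] [IsManifold (𝓡 n) 1 M]
    [RiemannianBundle (fun x : M => TangentSpace (𝓡 n) x)]
    [IsContinuousRiemannianBundle (EuclideanSpace ℝ (Fin n))
      (fun x : M => TangentSpace (𝓡 n) x)] [IsRiemannianManifold (𝓡 n) M] (p : M) :
    ∃ L : EuclideanSpace ℝ (Fin n) ≃L[ℝ] EuclideanSpace ℝ (Fin n),
      (∀ v : TangentSpace (𝓡 n) p,
        ‖L (mfderiv (𝓡 n) 𝓘(ℝ, EuclideanSpace ℝ (Fin n)) (extChartAt (𝓡 n) p) p v)‖ = ‖v‖) ∧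
      ∀ r : ℝ, 1 < r → ∃ U ∈ 𝓝 p, U ⊆ (chartAt (EuclideanSpace ℝ (Fin n)) p).source ∧
        ∀ x ∈ U, ∀ y ∈ U,
          ‖L (extChartAt (𝓡 n) p x) - L (extChartAt (𝓡 n) p y)‖ ≤ r * dist x y ∧
          dist x y ≤ r * ‖L (extChartAt (𝓡 n) p x) - L (extChartAt (𝓡 n) p y)‖ := by
  obtain ⟨L, hL, hLr⟩ := exists_isometric_frame (n := n) p
  refine ⟨L, fun v => ?_, fun r hr => ?_⟩
  · rw [← TangentBundle.continuousLinearMapAt_trivializationAt (mem_chart_source _ p)]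
    exact hL v
  have hr0 : 0 ≤ r := by linarith
  have hsrc := chart_source_mem_nhds (EuclideanSpace ℝ (Fin n)) p
  obtain ⟨δ, hδ, hball⟩ := Metric.mem_nhds_iff.1 (inter_mem hsrc (hLr r hr))
  have htgt : {z | L.symm z ∈ (extChartAt (𝓡 n) p).target ∧
      (extChartAt (𝓡 n) p).symm (L.symm z) ∈ Metric.ball p δ} ∈ 𝓝 (L (extChartAt (𝓡 n) p p)) := by
    have hc : Tendsto L.symm (𝓝 (L (extChartAt (𝓡 n) p p))) (𝓝 (extChartAt (𝓡 n) p p)) := by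
      simpa using L.symm.continuous.tendsto (L (extChartAt (𝓡 n) p p))
    have hc2 : Tendsto (extChartAt (𝓡 n) p).symm (𝓝 (extChartAt (𝓡 n) p p)) (𝓝 p) := by
      simpa using (continuousAt_extChartAt_symm (I := 𝓡 n) p).tendsto
    exact inter_mem (hc (extChartAt_target_mem_nhds p))
      ((hc2.comp hc) (Metric.ball_mem_nhds p hδ))
  obtain ⟨ρ, hρ, hρball⟩ := Metric.mem_nhds_iff.1 htgt
  -- A curve of length below 2δ/3 starting in the ball of radius δ/3 stays in the ball of radius δ,
  -- where the derivative bounds hold. The second condition puts the coordinates in a convex set, so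
  -- that segments stay in the chart.
  refine ⟨Metric.ball p (δ / 3) ∩ {x | L (extChartAt (𝓡 n) p x) ∈
    Metric.ball (L (extChartAt (𝓡 n) p p)) ρ}, ?_, ?_, ?_⟩
  · refine inter_mem (Metric.ball_mem_nhds p (by positivity)) ?_
    exact ((L.continuous.continuousAt).comp (continuousAt_extChartAt (I := 𝓡 n) p))
      (Metric.ball_mem_nhds _ hρ)
  · exact fun x hx => (hball (Metric.ball_subset_ball (by linarith) hx.1)).1
  intro x hx y hy
  have hsx : x ∈ (extChartAt (𝓡 n) p).source := by
    rw [extChartAt_source]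
    exact (hball (Metric.ball_subset_ball (by linarith) hx.1)).1
  have hsy : y ∈ (extChartAt (𝓡 n) p).source := by
    rw [extChartAt_source]
    exact (hball (Metric.ball_subset_ball (by linarith) hy.1)).1
  have hxp := Metric.mem_ball.1 hx.1
  have hyp := Metric.mem_ball.1 hy.1
  constructor
  · refine le_of_forall_gt fun c hc => ?_
    have hc' : dist x y < c / r := (lt_div_iff₀' (by linarith)).2 hc
    have hxy : dist x y < 2 * δ / 3 := by
      linarith [dist_triangle_right x y p]
    obtain ⟨s, hs1, hs2⟩ := exists_between (lt_min hc' hxy)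
    have hed : riemannianEDist (𝓡 n) y x < ENNReal.ofReal s := by
      rw [← IsRiemannianManifold.out, edist_comm, edist_dist]
      exact (ENNReal.ofReal_lt_ofReal_iff (dist_nonneg.trans_lt hs1)).2 hs1
    obtain ⟨γ, h0, h1, hγ, hlen, -, -⟩ :=
      exists_lt_locally_constant_of_riemannianEDist_lt hed zero_lt_one
    have hin : ∀ t ∈ Icc (0 : ℝ) 1, γ t ∈ Metric.ball p δ := by
      intro t ht
      have h3 : edist y (γ t) < ENNReal.ofReal s := by
        rw [IsRiemannianManifold.out (I := 𝓡 n)]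
        exact ((riemannianEDist_le_pathELength hγ.contMDiffOn h0 rfl ht.1).trans
          (pathELength_mono le_rfl ht.2)).trans_lt hlen
      rw [edist_dist, ENNReal.ofReal_lt_ofReal_iff (dist_nonneg.trans_lt hs1)] at h3
      have := hs2.trans_le (min_le_right _ _)
      rw [Metric.mem_ball]
      linarith [dist_triangle_left (γ t) p y]
    have hmain := enorm_extChartAt_comp_sub_le hr0 hγ (L := L) (p := p) fun t ht =>
      ⟨(hball (hin t ht)).1, norm_mfderiv_extChartAt_le (hball (hin t ht)).1
        (hball (hin t ht)).2.1⟩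
    rw [h0, h1] at hmain
    have h4 : ‖L (extChartAt (𝓡 n) p x) - L (extChartAt (𝓡 n) p y)‖ₑ ≤
        ENNReal.ofReal (r * s) := by
      rw [ENNReal.ofReal_mul hr0]
      exact hmain.trans (by gcongr)
    rw [← ofReal_norm, ENNReal.ofReal_le_ofReal_iff
      (mul_nonneg hr0 (dist_nonneg.trans hs1.le))] at h4
    have := hs2.trans_le (min_le_left _ _)
    exact h4.trans_lt ((lt_div_iff₀' (by linarith)).1 this)
  · have hseg : segment ℝ (L (extChartAt (𝓡 n) p x)) (L (extChartAt (𝓡 n) p y)) ⊆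
        Metric.ball (L (extChartAt (𝓡 n) p p)) ρ :=
      (convex_ball _ _).segment_subset hx.2 hy.2
    have hmain := riemannianEDist_extChartAt_symm_le (L := L) (p := p) fun z hz =>
      ⟨(hρball (hseg hz)).1, norm_mfderivWithin_extChartAt_symm_le (hρball (hseg hz)).1
        (hball (hρball (hseg hz)).2).2.2⟩
    rw [L.symm_apply_apply, L.symm_apply_apply, (extChartAt (𝓡 n) p).left_inv hsx,
      (extChartAt (𝓡 n) p).left_inv hsy, ← IsRiemannianManifold.out, edist_dist,
      ENNReal.ofReal_le_ofReal_iff (by positivity), norm_sub_rev] at hmain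
    exact hmain

/-! ### From pointwise to global Lipschitz bounds -/

/-- A function on a Riemannian manifold whose pointwise Lipschitz constant is at most `K` everywhere
is globally `K`-Lipschitz. -/
theorem abs_sub_le_of_eventually [MetricSpace M]
    [ChartedSpace (EuclideanSpace ℝ (Fin n)) M] [IsManifold (𝓡 n) 1 M]
    [RiemannianBundle (fun x : M => TangentSpace (𝓡 n) x)]
    [IsRiemannianManifold (𝓡 n) M] {f : M → ℝ} {K : ℝ} (hK : 0 ≤ K)
    (hf : ∀ x, ∀ᶠ y in 𝓝 x, |f y - f x| ≤ K * dist y x) (x y : M) :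
    |f x - f y| ≤ K * dist x y := by
  refine le_of_forall_gt fun c hc => ?_
  obtain ⟨s, hs, hsc⟩ : ∃ s, dist x y < s ∧ K * s < c := by
    have hK1 : 0 < K + 1 := by linarith
    refine ⟨dist x y + (c - K * dist x y) / (K + 1), ?_, ?_⟩
    · have := div_pos (sub_pos.2 hc) hK1
      linarith
    · have : (c - K * dist x y) / (K + 1) * (K + 1) = c - K * dist x y :=
        div_mul_cancel₀ _ hK1.ne'
      have h2 := div_pos (sub_pos.2 hc) hK1
      nlinarith
  have hs0 : 0 < s := dist_nonneg.trans_lt hs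
  have hed : riemannianEDist (𝓡 n) x y < ENNReal.ofReal s := by
    rw [← IsRiemannianManifold.out, edist_dist]
    exact (ENNReal.ofReal_lt_ofReal_iff hs0).2 hs
  obtain ⟨γ, h0, h1, hγ, hlen, -, -⟩ :=
    exists_lt_locally_constant_of_riemannianEDist_lt hed zero_lt_one
  set l : ℝ → ℝ := fun t => (pathELength (𝓡 n) γ 0 t).toReal with hl
  have hfin : ∀ t ≤ 1, pathELength (𝓡 n) γ 0 t ≠ ⊤ := fun t ht =>
    ((pathELength_mono le_rfl ht).trans_lt (hlen.trans ENNReal.ofReal_lt_top)).ne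
  have hdist : ∀ a b, 0 ≤ a → a ≤ b → b ≤ 1 → dist (γ b) (γ a) ≤ l b - l a := by
    intro a b ha hab hb
    have h2 : edist (γ a) (γ b) ≤ pathELength (𝓡 n) γ a b := by
      rw [IsRiemannianManifold.out (I := 𝓡 n)]
      exact riemannianEDist_le_pathELength hγ.contMDiffOn rfl rfl hab
    have h3 := pathELength_add (I := 𝓡 n) (γ := γ) ha hab
    have h4 : pathELength (𝓡 n) γ a b ≠ ⊤ := fun h => hfin b hb (by rw [← h3, h, add_top])
    have h5 : l b = l a + (pathELength (𝓡 n) γ a b).toReal := by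
      simp only [hl]
      rw [← h3, ENNReal.toReal_add (hfin a (hab.trans hb)) h4]
    rw [h5, dist_comm, dist_edist]
    linarith [ENNReal.toReal_mono h4 h2]
  have hstep : ∀ a b, 0 ≤ a → a ≤ b → b ≤ 1 →
      |f (γ b) - f (γ a)| ≤ K * dist (γ b) (γ a) → |f (γ a) - f (γ 0)| ≤ K * l a →
      |f (γ b) - f (γ 0)| ≤ K * l b := by
    intro a b ha hab hb h2 h3
    have h4 := mul_le_mul_of_nonneg_left (hdist a b ha hab hb) hK
    have h5 := abs_sub_le (f (γ b)) (f (γ a)) (f (γ 0))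
    linarith
  -- Continuous induction along the curve, with `l` its arc length. The pointwise bound at the
  -- supremum is used twice: against earlier times, to show that the supremum belongs to `A`, and
  -- against later times, to go beyond it unless it is 1.
  set A : Set ℝ := {t | t ∈ Icc (0 : ℝ) 1 ∧ |f (γ t) - f (γ 0)| ≤ K * l t} with hA
  have hA0 : (0 : ℝ) ∈ A := ⟨⟨le_rfl, zero_le_one⟩, by simp [hl]⟩
  have hAb : BddAbove A := ⟨1, fun t ht => ht.1.2⟩
  have hm0 : 0 ≤ sSup A := le_csSup hAb hA0
  have hm1 : sSup A ≤ 1 := csSup_le ⟨0, hA0⟩ fun t ht => ht.1.2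
  obtain ⟨δ, hδ, hδf⟩ := Metric.eventually_nhds_iff.1
    ((hγ.continuous.tendsto (sSup A)).eventually (hf (γ (sSup A))))
  have hmA : |f (γ (sSup A)) - f (γ 0)| ≤ K * l (sSup A) := by
    obtain ⟨a, ha, ham⟩ := exists_lt_of_lt_csSup ⟨0, hA0⟩ (sub_lt_self (sSup A) hδ)
    have ham' := le_csSup hAb ha
    refine hstep a (sSup A) ha.1.1 ham' hm1 ?_ ha.2
    rw [abs_sub_comm, dist_comm]
    exact hδf (by rw [Real.dist_eq, abs_lt]; constructor <;> linarith)
  have hm : sSup A = 1 := by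
    by_contra hne
    have hlt := lt_of_le_of_ne hm1 hne
    have hb : sSup A < min 1 (sSup A + δ / 2) := lt_min hlt (by linarith)
    have hb2 := min_le_right 1 (sSup A + δ / 2)
    have : min 1 (sSup A + δ / 2) ∈ A := by
      refine ⟨⟨hm0.trans hb.le, min_le_left _ _⟩, ?_⟩
      refine hstep (sSup A) _ hm0 hb.le (min_le_left _ _) ?_ hmA
      exact hδf (by rw [Real.dist_eq, abs_lt]; constructor <;> linarith)
    exact absurd (le_csSup hAb this) (not_le.2 hb)
  rw [hm, h0, h1] at hmA
  have hl1 : l 1 ≤ s := ENNReal.toReal_le_of_le_ofReal hs0.le hlen.le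
  rw [abs_sub_comm]
  exact (hmA.trans (mul_le_mul_of_nonneg_left hl1 hK)).trans_lt hsc

/-! ### Smoothing of Lipschitz functions -/

/-- A Lipschitz function is uniformly close to smooth functions with the same Lipschitz constant. -/
theorem exists_contDiff_lipschitzWith_near {E : Type*} [NormedAddCommGroup E] [NormedSpace ℝ E]
    [FiniteDimensional ℝ E] {f : E → ℝ} {K : NNReal} (hf : LipschitzWith K f)
    {ε : ℝ} (hε : 0 < ε) :
    ∃ g : E → ℝ, ContDiff ℝ ∞ g ∧ LipschitzWith K g ∧ ∀ x, |g x - f x| ≤ ε := by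
  borelize E
  obtain ⟨δ, hδ, hKδ⟩ : ∃ δ : ℝ, 0 < δ ∧ K * δ ≤ ε := by
    refine ⟨ε / (K + 1), by positivity, ?_⟩
    rw [mul_div_assoc', div_le_iff₀ (by positivity)]
    nlinarith [K.coe_nonneg]
  let φ : ContDiffBump (0 : E) := ⟨δ / 2, δ, by positivity, by linarith⟩
  let μ : MeasureTheory.Measure E := MeasureTheory.Measure.addHaar
  have hli : MeasureTheory.LocallyIntegrable f μ := hf.continuous.locallyIntegrable
  have hex : MeasureTheory.ConvolutionExists (φ.normed μ) f (ContinuousLinearMap.lsmul ℝ ℝ) μ :=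
    φ.hasCompactSupport_normed.convolutionExists_left _ φ.continuous_normed hli
  -- An average of translates of `f` by vectors shorter than `δ`: it keeps the constant `K` and
  -- moves values by at most `K * δ`.
  refine ⟨MeasureTheory.convolution (φ.normed μ) f (ContinuousLinearMap.lsmul ℝ ℝ) μ, ?_, ?_, ?_⟩
  · exact φ.hasCompactSupport_normed.contDiff_convolution_left _ φ.contDiff_normed hli
  · refine LipschitzWith.of_dist_le_mul fun x y => ?_
    rw [dist_eq_norm, MeasureTheory.convolution, MeasureTheory.convolution,
      ← MeasureTheory.integral_sub (hex x) (hex y)]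
    have hb : ∀ t, ‖(ContinuousLinearMap.lsmul ℝ ℝ) (φ.normed μ t) (f (x - t)) -
        (ContinuousLinearMap.lsmul ℝ ℝ) (φ.normed μ t) (f (y - t))‖ ≤
        φ.normed μ t * (K * dist x y) := by
      intro t
      rw [← map_sub, ContinuousLinearMap.lsmul_apply, smul_eq_mul, norm_mul,
        Real.norm_of_nonneg (φ.nonneg_normed t)]
      refine mul_le_mul_of_nonneg_left ?_ (φ.nonneg_normed t)
      have := hf.dist_le_mul (x - t) (y - t)
      rwa [dist_sub_right, dist_eq_norm] at this
    refine (MeasureTheory.norm_integral_le_of_norm_le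
      (φ.integrable_normed.mul_const _) (Eventually.of_forall hb)).trans_eq ?_
    rw [MeasureTheory.integral_mul_const, φ.integral_normed, one_mul]
  · intro x
    refine φ.dist_normed_convolution_le hf.continuous.aestronglyMeasurable fun y hy => ?_
    refine (hf.dist_le_mul y x).trans (le_trans ?_ hKδ)
    exact mul_le_mul_of_nonneg_left (Metric.mem_ball.1 hy).le K.coe_nonneg

/-- Holds in coordinates, and charts are locally bi-Lipschitz. It serves to bound the slopes of the
functions of a partition of unity. -/
theorem ContMDiff.locallyLipschitz_of_isRiemannianManifold [MetricSpace M]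
    [ChartedSpace (EuclideanSpace ℝ (Fin n)) M] [IsManifold (𝓡 n) 1 M]
    [RiemannianBundle (fun x : M => TangentSpace (𝓡 n) x)]
    [IsContinuousRiemannianBundle (EuclideanSpace ℝ (Fin n))
      (fun x : M => TangentSpace (𝓡 n) x)] [IsRiemannianManifold (𝓡 n) M]
    {f : M → ℝ} (hf : ContMDiff (𝓡 n) 𝓘(ℝ, ℝ) 1 f) : LocallyLipschitz f := by
  intro p
  obtain ⟨L, -, hL⟩ := exists_almost_isometric_chart (n := n) p
  obtain ⟨U, hU, hUs, hUL⟩ := hL 2 one_lt_two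
  have h1 : ContDiffAt ℝ 1 (f ∘ (extChartAt (𝓡 n) p).symm) (extChartAt (𝓡 n) p p) := by
    have := (contMDiffAt_iff_source (I := 𝓡 n) (x := p)).1 (hf p)
    simpa [contMDiffWithinAt_univ, contMDiffAt_iff_contDiffAt] using this
  have h2 : ContDiffAt ℝ 1 (fun z => f ((extChartAt (𝓡 n) p).symm (L.symm z)))
      (L (extChartAt (𝓡 n) p p)) := by
    refine ContDiffAt.comp (f := L.symm) (g := f ∘ (extChartAt (𝓡 n) p).symm) _ ?_
      L.symm.contDiff.contDiffAt
    rwa [L.symm_apply_apply]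
  obtain ⟨K, t, ht, hK⟩ := h2.exists_lipschitzOnWith
  have ht' : {x | L (extChartAt (𝓡 n) p x) ∈ t} ∈ 𝓝 p :=
    ((L.continuous.continuousAt).comp (continuousAt_extChartAt (I := 𝓡 n) p)) ht
  refine ⟨K * 2, U ∩ {x | L (extChartAt (𝓡 n) p x) ∈ t}, inter_mem hU ht', ?_⟩
  refine LipschitzOnWith.of_dist_le_mul fun x hx y hy => ?_
  have hinv : ∀ x ∈ U, (extChartAt (𝓡 n) p).symm (extChartAt (𝓡 n) p x) = x := fun x hx =>
    (extChartAt (𝓡 n) p).left_inv (by rw [extChartAt_source]; exact hUs hx)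
  have h3 := hK.dist_le_mul _ hx.2 _ hy.2
  rw [L.symm_apply_apply, L.symm_apply_apply, hinv x hx.1, hinv y hy.1] at h3
  refine h3.trans ?_
  rw [dist_eq_norm, NNReal.coe_mul, mul_assoc]
  exact mul_le_mul_of_nonneg_left (hUL x hx.1 y hy.1).1 K.coe_nonneg

/-- Read `f` in an almost isometric chart, extend it from the image to the whole vector space as a
Lipschitz function, mollify and pull back. The set `U` does not depend on `δ`: the partition of
unity can be fixed first and the accuracy adapted to it afterwards. -/
theorem exists_local_smoothing [MetricSpace M]
    [ChartedSpace (EuclideanSpace ℝ (Fin n)) M] [IsManifold (𝓡 n) ∞ M]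
    [RiemannianBundle (fun x : M => TangentSpace (𝓡 n) x)]
    [IsContinuousRiemannianBundle (EuclideanSpace ℝ (Fin n))
      (fun x : M => TangentSpace (𝓡 n) x)] [IsRiemannianManifold (𝓡 n) M]
    {f : M → ℝ} {L₀ K : ℝ} (hL₀ : 0 ≤ L₀) (hLK : L₀ < K)
    (hf : ∀ x y, |f x - f y| ≤ L₀ * dist x y) (p : M) :
    ∃ U, IsOpen U ∧ p ∈ U ∧ ∀ δ : ℝ, 0 < δ → ∃ g : M → ℝ,
      (∀ x ∈ U, ContMDiffAt (𝓡 n) 𝓘(ℝ, ℝ) ∞ g x) ∧ (∀ x ∈ U, |g x - f x| ≤ δ) ∧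
      ∀ x ∈ U, ∀ y ∈ U, |g x - g y| ≤ K * dist x y := by
  -- One factor `r` is lost on entering the chart and one on leaving it.
  obtain ⟨r, hr, hrK⟩ : ∃ r : ℝ, 1 < r ∧ L₀ * r * r ≤ K := by
    have hc : Tendsto (fun r : ℝ => L₀ * r * r) (𝓝[>] 1) (𝓝 (L₀ * 1 * 1)) :=
      tendsto_nhdsWithin_of_tendsto_nhds (Continuous.tendsto (by fun_prop) 1)
    obtain ⟨r, h1, h2⟩ := ((hc.eventually (gt_mem_nhds (by simpa using hLK))).and
      self_mem_nhdsWithin).exists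
    exact ⟨r, h2, h1.le⟩
  have hr0 : 0 < r := by linarith
  obtain ⟨L, -, hL⟩ := exists_almost_isometric_chart (n := n) p
  obtain ⟨U, hU, hUs, hUL⟩ := hL r hr
  refine ⟨interior U, isOpen_interior, mem_interior_iff_mem_nhds.2 hU, fun δ hδ => ?_⟩
  set Ψ : M → EuclideanSpace ℝ (Fin n) := fun x => L (extChartAt (𝓡 n) p x) with hΨ
  have hinv : ∀ x ∈ U, (extChartAt (𝓡 n) p).symm (L.symm (Ψ x)) = x := fun x hx => by
    rw [hΨ, L.symm_apply_apply]
    exact (extChartAt (𝓡 n) p).left_inv (by rw [extChartAt_source]; exact hUs hx)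
  have hco : ((L₀ * r).toNNReal : ℝ) = L₀ * r := Real.coe_toNNReal _ (by positivity)
  have hlip : LipschitzOnWith (Real.toNNReal (L₀ * r))
      (fun z => f ((extChartAt (𝓡 n) p).symm (L.symm z))) (Ψ '' U) := by
    refine LipschitzOnWith.of_dist_le_mul ?_
    rintro _ ⟨x, hx, rfl⟩ _ ⟨y, hy, rfl⟩
    rw [hinv x hx, hinv y hy, Real.dist_eq, dist_eq_norm, hco, mul_assoc]
    exact (hf x y).trans (mul_le_mul_of_nonneg_left (hUL x hx y hy).2 hL₀)
  obtain ⟨F, hF, hFf⟩ := hlip.extend_real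
  obtain ⟨G, hG, hGl, hGF⟩ := exists_contDiff_lipschitzWith_near hF hδ
  refine ⟨fun x => G (Ψ x), fun x hx => ?_, fun x hx => ?_, fun x hx y hy => ?_⟩
  · have h1 : ContMDiffAt (𝓡 n) 𝓘(ℝ, EuclideanSpace ℝ (Fin n)) ∞ (extChartAt (𝓡 n) p) x :=
      contMDiffAt_extChartAt' (hUs (interior_subset hx))
    have h2 : ContMDiff 𝓘(ℝ, EuclideanSpace ℝ (Fin n)) 𝓘(ℝ, ℝ) ∞ (fun z => G (L z)) :=
      (hG.comp L.contDiff).contMDiff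
    exact h2.contMDiffAt.comp x h1
  · have hx' := interior_subset hx
    have h1 := hFf (mem_image_of_mem Ψ hx')
    simp only [hinv x hx'] at h1
    change |G (Ψ x) - f x| ≤ δ
    rw [h1]
    exact hGF _
  · have hx' := interior_subset hx
    have hy' := interior_subset hy
    have h1 := hGl.dist_le_mul (Ψ x) (Ψ y)
    rw [Real.dist_eq, dist_eq_norm, hco] at h1
    refine h1.trans ((mul_le_mul_of_nonneg_left (hUL x hx' y hy').1 (by positivity)).trans ?_)
    rw [← mul_assoc]
    exact mul_le_mul_of_nonneg_right hrK dist_nonneg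

/-- A Lipschitz function on a Riemannian manifold can be approximated, up to a positive continuous
error, by smooth functions whose Lipschitz constant is arbitrarily close to the original one. -/
theorem exists_contMDiff_lipschitz_near [MetricSpace M]
    [ChartedSpace (EuclideanSpace ℝ (Fin n)) M] [IsManifold (𝓡 n) ∞ M] [SecondCountableTopology M]
    [RiemannianBundle (fun x : M => TangentSpace (𝓡 n) x)]
    [IsContinuousRiemannianBundle (EuclideanSpace ℝ (Fin n))
      (fun x : M => TangentSpace (𝓡 n) x)] [IsRiemannianManifold (𝓡 n) M]
    {f η : M → ℝ} {L₀ K : ℝ} (hL₀ : 0 ≤ L₀) (hLK : L₀ < K)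
    (hf : ∀ x y, |f x - f y| ≤ L₀ * dist x y) (hη : Continuous η) (hη0 : ∀ x, 0 < η x) :
    ∃ g : M → ℝ, ContMDiff (𝓡 n) 𝓘(ℝ, ℝ) ∞ g ∧ (∀ x, |g x - f x| ≤ η x) ∧
      ∀ x y, |g x - g y| ≤ K * dist x y := by
  have : LocallyCompactSpace M := Manifold.locallyCompact_of_finiteDimensional (𝓡 n)
  -- `K'` is for the local smoothings; `K - K'` is reserved for the slopes of the cutoffs.
  obtain ⟨K', hLK', hKK'⟩ := exists_between hLK
  choose U hUo hUp hU using exists_local_smoothing (n := n) hL₀ hLK' hf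
  choose C hCn hCU hC using fun p => local_compact_nhds ((hUo p).mem_nhds (hUp p))
  obtain ⟨s, hs, hsU⟩ := TopologicalSpace.countable_cover_nhds
    (f := fun p => interior (C p)) fun p => interior_mem_nhds.2 (hCn p)
  have := hs.to_subtype
  have : Encodable s := Encodable.ofCountable s
  obtain ⟨ρ, hρ⟩ := SmoothPartitionOfUnity.exists_isSubordinate (𝓡 n) isClosed_univ
    (fun i : s => interior (C i)) (fun i => isOpen_interior)
    (by rw [← hsU, biUnion_eq_iUnion])
  have hκ : ∀ i : s, ∃ κ, LipschitzOnWith κ (ρ i) (C i) := fun i =>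
    LocallyLipschitzOn.exists_lipschitzOnWith_of_compact (hC i)
      (((ρ i).contMDiff.of_le (by simp)).locallyLipschitz_of_isRiemannianManifold.locallyLipschitzOn)
  choose κ hκ using hκ
  have hm : ∀ i : s, ∃ m, 0 < m ∧ ∀ x ∈ C i, m ≤ η x := by
    intro i
    obtain ⟨x, -, hx⟩ := (hC i).exists_isMinOn ⟨i, mem_of_mem_nhds (hCn i)⟩ hη.continuousOn
    exact ⟨η x, hη0 x, fun y hy => hx hy⟩
  choose m hm0 hm using hm
  -- The budget `K - K'` is divided among the countably many charts. The first term of the minimum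
  -- below controls the uniform error, the second gives `κ i * |G i - f| ≤ ε i`.
  obtain ⟨ε, hε0, c, hεc, hc⟩ := posSumOfEncodable (sub_pos.2 hKK') s
  have hδ : ∀ i : s, 0 < min (m i) (ε i / (κ i + 1)) := fun i =>
    lt_min (hm0 i) (div_pos (hε0 i) (by positivity))
  choose G hGs hGf hGl using fun i : s => hU i _ (hδ i)
  have hin : ∀ i : s, ∀ x, x ∈ tsupport (ρ i) → x ∈ C i := fun i x hx => interior_subset (hρ i hx)
  have hκG : ∀ i : s, ∀ x ∈ C i, κ i * |G i x - f x| ≤ ε i := by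
    intro i x hx
    have h1 := (hGf i x (hCU i hx)).trans (min_le_right _ _)
    rw [le_div_iff₀ (by positivity)] at h1
    nlinarith [abs_nonneg (G i x - f x)]
  refine ⟨fun x => ∑ᶠ i, ρ i x • G i x, ρ.contMDiff_finsum_smul fun i x hx =>
    hGs i x (hCU i (hin i x hx)), fun x => ?_, ?_⟩
  · have h1 := ρ.finsum_smul_mem_convex (g := G) (t := Icc (f x - η x) (f x + η x)) (mem_univ x)
      (fun i hi => by
        have hx := hin i x (subset_tsupport _ hi)
        have h2 := abs_le.1 ((hGf i x (hCU i hx)).trans ((min_le_left _ _).trans (hm i x hx)))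
        constructor <;> linarith [h2.1, h2.2]) (convex_Icc _ _)
    rw [abs_le]
    constructor <;> linarith [h1.1, h1.2]
  refine abs_sub_le_of_eventually (n := n) (by linarith) fun x => ?_
  have hloc : ∀ᶠ y in 𝓝 x, ∀ j ∈ ρ.fintsupport x, y ∈ C j := by
    rw [Filter.eventually_all_finset]
    intro j hj
    exact mem_interior_iff_mem_nhds.1 (hρ j ((ρ.mem_fintsupport_iff x j).1 hj))
  filter_upwards [ρ.eventually_finsupport_subset x, hloc] with y hy hyC
  have hxC := hloc.self_of_nhds
  have hsum : ∀ z, ρ.finsupport z ⊆ ρ.fintsupport x →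
      ∑ᶠ i, ρ i z • G i z = ∑ i ∈ ρ.fintsupport x, ρ i z * G i z := by
    intro z hz
    refine finsum_eq_sum_of_support_subset _ fun i hi => hz ?_
    rw [ρ.mem_finsupport]
    exact fun h0 => hi (by simp [h0])
  have hx := ρ.finsupport_subset_fintsupport x
  have e1 := ρ.sum_finsupport' x (mem_univ x) hx
  have e2 := ρ.sum_finsupport' y (mem_univ y) hy
  -- The weights sum to 1 at both points, so `f x` may be subtracted from the factors of `ρ i y - ρ
  -- i x`; these slopes then multiply only the small errors `G i x - f x`.
  have hdecomp : ∑ i ∈ ρ.fintsupport x, ρ i y * G i y - ∑ i ∈ ρ.fintsupport x, ρ i x * G i x =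
      ∑ i ∈ ρ.fintsupport x,
        (ρ i y * (G i y - G i x) + (ρ i y - ρ i x) * (G i x - f x)) := by
    have : f x * ∑ i ∈ ρ.fintsupport x, ρ i y = f x * ∑ i ∈ ρ.fintsupport x, ρ i x := by
      rw [e1, e2]
    rw [Finset.mul_sum, Finset.mul_sum] at this
    rw [← sub_eq_zero] at this ⊢
    rw [← Finset.sum_sub_distrib, ← Finset.sum_sub_distrib]
    rw [← Finset.sum_sub_distrib] at this
    rw [← this]
    exact Finset.sum_congr rfl fun i _ => by ring
  rw [hsum y hy, hsum x hx, hdecomp]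
  calc _ ≤ ∑ i ∈ ρ.fintsupport x, (ρ i y * (K' * dist y x) + ε i * dist y x) := by
        refine (Finset.abs_sum_le_sum_abs _ _).trans (Finset.sum_le_sum fun i hi => ?_)
        refine (abs_add_le _ _).trans (add_le_add ?_ ?_)
        · rw [abs_mul, abs_of_nonneg (ρ.nonneg i y)]
          exact mul_le_mul_of_nonneg_left (hGl i y (hCU i (hyC i hi)) x (hCU i (hxC i hi)))
            (ρ.nonneg i y)
        · rw [abs_mul]
          have h1 := (hκ i).dist_le_mul y (hyC i hi) x (hxC i hi)
          rw [Real.dist_eq] at h1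
          calc _ ≤ (κ i * dist y x) * |G i x - f x| :=
                mul_le_mul_of_nonneg_right h1 (abs_nonneg _)
            _ = (κ i * |G i x - f x|) * dist y x := by ring
            _ ≤ _ := mul_le_mul_of_nonneg_right (hκG i x (hxC i hi)) dist_nonneg
    _ = K' * dist y x + (∑ i ∈ ρ.fintsupport x, ε i) * dist y x := by
        rw [Finset.sum_add_distrib, ← Finset.sum_mul, ← Finset.sum_mul, e2, one_mul]
    _ ≤ K' * dist y x + (K - K') * dist y x := by
        have := (sum_le_hasSum (ρ.fintsupport x) (fun i _ => (hε0 i).le) hεc).trans hc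
        gcongr
    _ = K * dist y x := by ring

end

/-! ### Barycentric coordinates, faces and vertices -/

theorem baryCoord_sum_smul {d : ℕ} {ι : Type*} (s : Finset ι) (c : ι → ℝ)
    (x : ι → EuclideanSpace ℝ (Fin d)) (hc : ∑ j ∈ s, c j = 1) (k : Fin (d + 1)) :
    baryCoord (∑ j ∈ s, c j • x j) k = ∑ j ∈ s, c j * baryCoord (x j) k := by
  refine Fin.cases ?_ (fun i => ?_) k
  · simp only [baryCoord, Fin.cons_zero, mul_sub, Finset.sum_sub_distrib, mul_one, hc]
    congr 1
    simp only [WithLp.ofLp_sum, WithLp.ofLp_smul, Finset.sum_apply, Pi.smul_apply, smul_eq_mul,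
      Finset.mul_sum]
    exact Finset.sum_comm
  · simp [baryCoord]

theorem baryCoord_refVertex {d : ℕ} (i k : Fin (d + 1)) :
    baryCoord (refVertex d i) k = if i = k then 1 else 0 := by
  refine Fin.cases ?_ (fun i => ?_) i <;> refine Fin.cases ?_ (fun k => ?_) k
  · simp [baryCoord, refVertex]
  · simp [baryCoord, refVertex, (Fin.succ_ne_zero k).symm]
  · simp [baryCoord, refVertex]
  · simp [baryCoord, refVertex, eq_comm]

theorem baryCoord_faceMap {l d : ℕ} (σ : Fin (l + 1) ↪o Fin (d + 1)) (x : refSimplex l)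
    (k : Fin (d + 1)) :
    baryCoord (faceMap σ x : EuclideanSpace ℝ (Fin d)) k =
      ∑ j, if σ j = k then baryCoord (x : EuclideanSpace ℝ (Fin l)) j else 0 := by
  rw [faceMap, baryCoord_sum_smul _ _ _ (sum_baryCoord _)]
  simp [baryCoord_refVertex]

/-- The inclusion of the index `j` among the indices of the vertices of `Δ_d`. -/
def vertexEmbedding {d : ℕ} (j : Fin (d + 1)) : Fin (0 + 1) ↪o Fin (d + 1) :=
  OrderEmbedding.ofStrictMono (fun _ => j) fun a b h => absurd h (by omega)

theorem faceMap_refVertex {l d : ℕ} (σ : Fin (l + 1) ↪o Fin (d + 1)) (j : Fin (l + 1)) :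
    faceMap σ ⟨refVertex l j, refVertex_mem l j⟩ = ⟨refVertex d (σ j), refVertex_mem d (σ j)⟩ := by
  ext1
  simp [faceMap, baryCoord_refVertex]

theorem isCompact_refSimplex (d : ℕ) : IsCompact (refSimplex d) := by
  rw [refSimplex_eq_convexHull]
  exact (finite_range _).isCompact_convexHull ℝ

instance (d : ℕ) : CompactSpace (refSimplex d) :=
  isCompact_iff_compactSpace.1 (isCompact_refSimplex d)

theorem extendRef_coe {M : Type*} {d : ℕ} (f : refSimplex d → M) (x : refSimplex d) :
    extendRef f (x : EuclideanSpace ℝ (Fin d)) = f x :=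
  Subtype.val_injective.extend_apply _ _ _

section

variable {n : ℕ} {M : Type*} [TopologicalSpace M] [ChartedSpace (EuclideanSpace ℝ (Fin n)) M]

namespace SmoothSimplex

theorem continuous_toFun (T : SmoothSimplex n M) : Continuous T.toFun := by
  have h := T.smooth.continuousOn.domRestrict
  have : (refSimplex T.dim).domRestrict (extendRef T.toFun) = T.toFun := by
    ext x
    exact extendRef_coe _ x
  rwa [this] at h

theorem isCompact_image (T : SmoothSimplex n M) : IsCompact T.image :=
  isCompact_range T.continuous_toFun

/-- The vertex number `j` of a smooth simplex, as a point of the manifold. -/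
noncomputable def vertexPoint (T : SmoothSimplex n M) (j : Fin (T.dim + 1)) : M :=
  T.toFun ⟨refVertex T.dim j, refVertex_mem T.dim j⟩

theorem vertexPoint_mem (T : SmoothSimplex n M) (j : Fin (T.dim + 1)) :
    T.vertexPoint j ∈ T.image := mem_range_self _

/-- The vertex number `j` of a smooth simplex, as a simplex of dimension zero. -/
noncomputable def vertex (T : SmoothSimplex n M) (j : Fin (T.dim + 1)) : SmoothSimplex n M where
  dim := 0
  toFun _ := T.vertexPoint j
  smooth := by
    have : extendRef (fun _ : refSimplex 0 => T.vertexPoint j) = fun _ => T.vertexPoint j := by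
      ext x
      rw [Subsingleton.elim x (refVertex 0 0)]
      exact extendRef_coe _ ⟨refVertex 0 0, refVertex_mem 0 0⟩
    rw [this]
    exact contMDiffOn_const
  injective := fun x y _ => Subtype.ext (Subsingleton.elim _ _)
  immersion := fun x _ v w _ => by
    have : Subsingleton (EuclideanSpace ℝ (Fin 0)) := inferInstance
    exact this.elim v w

theorem image_vertex (T : SmoothSimplex n M) (j : Fin (T.dim + 1)) :
    (T.vertex j).image = {T.vertexPoint j} := by
  have : Nonempty (refSimplex (T.vertex j).dim) := ⟨⟨refVertex _ 0, refVertex_mem _ 0⟩⟩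
  exact range_const

theorem vertex_isSubsimplex (T : SmoothSimplex n M) (j : Fin (T.dim + 1)) :
    (T.vertex j).IsSubsimplex T := by
  refine ⟨vertexEmbedding j, fun x => ?_⟩
  have hx : x = ⟨refVertex 0 0, refVertex_mem 0 0⟩ :=
    Subtype.ext (Subsingleton.elim (α := EuclideanSpace ℝ (Fin 0)) _ _)
  rw [hx]
  exact congrArg T.toFun (faceMap_refVertex (l := 0)
    (vertexEmbedding j) 0).symm

theorem isSubsimplex_refl (T : SmoothSimplex n M) : T.IsSubsimplex T := by
  refine ⟨RelEmbedding.refl _, fun x => ?_⟩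
  congr 1
  ext1
  exact (sum_baryCoord_smul (x : EuclideanSpace ℝ (Fin T.dim))).symm

end SmoothSimplex

end

/-! ### Mesh size at the vertices and its piecewise linear interpolation -/

section

variable {n : ℕ} {M : Type*} [MetricSpace M] [ChartedSpace (EuclideanSpace ℝ (Fin n)) M]

theorem SmoothSimplex.diam_pos (T : SmoothSimplex n M) (hT : 0 < T.dim) :
    0 < Metric.diam T.image := by
  refine Metric.diam_pos ?_ T.isCompact_image.isBounded
  refine ⟨_, T.vertexPoint_mem 0, _, T.vertexPoint_mem (Fin.last _), fun h => ?_⟩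
  have h1 := congrArg (fun x : refSimplex T.dim => baryCoord (x : EuclideanSpace ℝ (Fin T.dim)) 0)
    (T.injective h)
  have h2 : Fin.last T.dim ≠ 0 := by
    rw [Ne, Fin.ext_iff]
    simpa using hT.ne'
  simp [baryCoord_refVertex, h2] at h1

namespace SmoothTriangulation

variable (𝒯 : SmoothTriangulation n M)

/-- The smallest diameter of a simplex of positive dimension that contains the point `p`. -/
noncomputable def pointMesh (p : M) : ℝ :=
  sInf {r | ∃ T ∈ 𝒯.simplices, 0 < T.dim ∧ p ∈ T.image ∧ r = Metric.diam T.image}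

theorem pointMesh_le_diam {T : SmoothSimplex n M} (hT : T ∈ 𝒯.simplices) (hd : 0 < T.dim) {p : M}
    (hp : p ∈ T.image) : 𝒯.pointMesh p ≤ Metric.diam T.image := by
  refine csInf_le ⟨0, ?_⟩ ⟨T, hT, hd, hp, rfl⟩
  rintro _ ⟨T', -, -, -, rfl⟩
  exact Metric.diam_nonneg

/-- The mesh size of a vertex depends only on the point, so all simplices meeting there share one
nodal value. -/
theorem meshSize_of_image_eq_singleton {T : SmoothSimplex n M} (hd : T.dim = 0) {p : M}
    (hp : T.image = {p}) : 𝒯.meshSize T = 𝒯.pointMesh p := by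
  simp [meshSize, hd, pointMesh, hp]

theorem meshSize_of_pos {T : SmoothSimplex n M} (hd : 0 < T.dim) :
    𝒯.meshSize T = Metric.diam T.image := if_pos hd

theorem image_eq_singleton {T : SmoothSimplex n M} (hd : T.dim = 0) (j : Fin (T.dim + 1)) :
    T.image = {T.vertexPoint j} := by
  refine Subset.antisymm ?_ (singleton_subset_iff.2 (T.vertexPoint_mem j))
  rintro _ ⟨x, rfl⟩
  have : Subsingleton (Fin T.dim) := by rw [hd]; infer_instance
  have : IsEmpty (Fin T.dim) := by rw [hd]; infer_instance
  exact congrArg T.toFun (Subtype.ext (Subsingleton.elim _ _))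

theorem pointMesh_vertexPoint_le {T : SmoothSimplex n M} (hT : T ∈ 𝒯.simplices)
    (j : Fin (T.dim + 1)) : 𝒯.pointMesh (T.vertexPoint j) ≤ 𝒯.meshSize T := by
  rcases Nat.eq_zero_or_pos T.dim with hd | hd
  · rw [𝒯.meshSize_of_image_eq_singleton hd (image_eq_singleton hd j)]
  · rw [𝒯.meshSize_of_pos hd]
    exact 𝒯.pointMesh_le_diam hT hd (T.vertexPoint_mem j)

/-- The piecewise linear interpolation of the mesh size at the vertices, on one simplex. -/
noncomputable def interpolant (T : SmoothSimplex n M) (x : EuclideanSpace ℝ (Fin T.dim)) : ℝ :=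
  ∑ j, baryCoord x j * 𝒯.pointMesh (T.vertexPoint j)

variable {𝒯}

/-- A face map pads barycentric coordinates by zeros and matches the vertices. -/
theorem interpolant_faceMap {S T : SmoothSimplex n M}
    {σ : Fin (S.dim + 1) ↪o Fin (T.dim + 1)} (hσ : ∀ x, S.toFun x = T.toFun (faceMap σ x))
    (x : refSimplex S.dim) :
    𝒯.interpolant T (faceMap σ x : EuclideanSpace ℝ (Fin T.dim)) = 𝒯.interpolant S x := by
  have hv : ∀ j, S.vertexPoint j = T.vertexPoint (σ j) := fun j => by
    rw [SmoothSimplex.vertexPoint, hσ, faceMap_refVertex]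
    rfl
  simp only [interpolant, baryCoord_faceMap, hv, Finset.sum_mul, ite_mul, zero_mul]
  rw [Finset.sum_comm]
  simp

/-- The common point comes from a common subsimplex, and injectivity of the two embeddings
identifies both parameters as images of one parameter `z` of that face. -/
theorem interpolant_eq_of_toFun_eq {T₁ T₂ : SmoothSimplex n M} (h₁ : T₁ ∈ 𝒯.simplices)
    (h₂ : T₂ ∈ 𝒯.simplices) {x₁ : refSimplex T₁.dim} {x₂ : refSimplex T₂.dim}
    (h : T₁.toFun x₁ = T₂.toFun x₂) : 𝒯.interpolant T₁ x₁ = 𝒯.interpolant T₂ x₂ := by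
  have hmem : T₁.toFun x₁ ∈ T₁.image ∩ T₂.image := ⟨mem_range_self _, h ▸ mem_range_self _⟩
  rcases 𝒯.inter T₁ h₁ T₂ h₂ with h0 | ⟨S, ⟨σ₁, hσ₁⟩, ⟨σ₂, hσ₂⟩, hS⟩
  · rw [h0] at hmem
    exact hmem.elim
  · rw [← hS] at hmem
    obtain ⟨z, hz⟩ := hmem
    have e₁ : faceMap σ₁ z = x₁ := T₁.injective (by rw [← hσ₁, hz])
    have e₂ : faceMap σ₂ z = x₂ := T₂.injective (by rw [← hσ₂, hz, h])
    rw [← e₁, ← e₂, interpolant_faceMap hσ₁, interpolant_faceMap hσ₂]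

variable (𝒯) in
/-- The interpolants on the simplices glue to a function on the manifold. -/
theorem exists_interpolation : ∃ f : M → ℝ, ∀ T ∈ 𝒯.simplices, ∀ x : refSimplex T.dim,
    f (T.toFun x) = 𝒯.interpolant T x := by
  choose T hT hd hx using 𝒯.cover
  choose ξ hξ using hx
  exact ⟨fun x => 𝒯.interpolant (T x) (ξ x), fun S hS x =>
    interpolant_eq_of_toFun_eq (hT _) hS (hξ _)⟩

theorem meshSize_le_mul_pointMesh {C : ℝ}
    (hC : ∀ T ∈ 𝒯.simplices, ∀ S : SmoothSimplex n M, S.IsSubsimplex T →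
      𝒯.meshSize T ≤ C * 𝒯.meshSize S)
    {T : SmoothSimplex n M} (hT : T ∈ 𝒯.simplices)
    (j : Fin (T.dim + 1)) : 𝒯.meshSize T ≤ C * 𝒯.pointMesh (T.vertexPoint j) := by
  have := hC T hT _ (T.vertex_isSubsimplex j)
  rwa [𝒯.meshSize_of_image_eq_singleton rfl (T.image_vertex j)] at this

theorem one_le_of_meshSize_le {C : ℝ}
    (hC : ∀ T ∈ 𝒯.simplices, ∀ S : SmoothSimplex n M, S.IsSubsimplex T →
      𝒯.meshSize T ≤ C * 𝒯.meshSize S)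
    {T : SmoothSimplex n M} (hT : T ∈ 𝒯.simplices) (hd : 0 < T.dim) :
    1 ≤ C := by
  have h := hC T hT T T.isSubsimplex_refl
  have h0 : 0 < 𝒯.meshSize T := by rw [𝒯.meshSize_of_pos hd]; exact T.diam_pos hd
  by_contra h1
  nlinarith [not_le.1 h1]

/-- A convex combination of vertex values: each is at least `meshSize T / C` because the vertex is a
subsimplex, and at most `meshSize T` by minimality. -/
theorem interpolant_mem_Icc {C : ℝ}
    (hC : ∀ T ∈ 𝒯.simplices, ∀ S : SmoothSimplex n M, S.IsSubsimplex T →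
      𝒯.meshSize T ≤ C * 𝒯.meshSize S)
    (hC0 : 0 < C) {T : SmoothSimplex n M} (hT : T ∈ 𝒯.simplices)
    (x : refSimplex T.dim) :
    𝒯.interpolant T x ∈ Icc (𝒯.meshSize T / C) (𝒯.meshSize T) := by
  have hs := sum_baryCoord (x : EuclideanSpace ℝ (Fin T.dim))
  constructor
  · calc 𝒯.meshSize T / C
        = ∑ j, baryCoord (x : EuclideanSpace ℝ (Fin T.dim)) j * (𝒯.meshSize T / C) := by
          rw [← Finset.sum_mul, hs, one_mul]
      _ ≤ _ := Finset.sum_le_sum fun j _ => mul_le_mul_of_nonneg_left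
          ((div_le_iff₀' hC0).2 (meshSize_le_mul_pointMesh hC hT j)) (baryCoord_nonneg x.2 j)
  · calc 𝒯.interpolant T x
        ≤ ∑ j, baryCoord (x : EuclideanSpace ℝ (Fin T.dim)) j * 𝒯.meshSize T :=
          Finset.sum_le_sum fun j _ => mul_le_mul_of_nonneg_left
            (𝒯.pointMesh_vertexPoint_le hT j) (baryCoord_nonneg x.2 j)
      _ = 𝒯.meshSize T := by rw [← Finset.sum_mul, hs, one_mul]

end SmoothTriangulation

end

/-! ### The Hilbert–Schmidt norm -/

section

variable {V W : Type*} [NormedAddCommGroup V] [InnerProductSpace ℝ V] [FiniteDimensional ℝ V]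
    [NormedAddCommGroup W] [InnerProductSpace ℝ W]

theorem hsNorm_nonneg (L : V →ₗ[ℝ] W) : 0 ≤ hsNorm L := Real.sqrt_nonneg _

theorem norm_apply_le_hsNorm (L : V →ₗ[ℝ] W) (v : V) : ‖L v‖ ≤ hsNorm L * ‖v‖ := by
  set b := stdOrthonormalBasis ℝ V
  calc ‖L v‖ = ‖∑ i, inner ℝ (b i) v • L (b i)‖ := by
        conv_lhs => rw [← b.sum_repr' v]
        simp
    _ ≤ ∑ i, ‖L (b i)‖ * |inner ℝ (b i) v| := by
        refine (norm_sum_le _ _).trans_eq (Finset.sum_congr rfl fun i _ => ?_)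
        rw [norm_smul, mul_comm, Real.norm_eq_abs]
    _ ≤ √(∑ i, ‖L (b i)‖ ^ 2) * √(∑ i, |inner ℝ (b i) v| ^ 2) :=
        Real.sum_mul_le_sqrt_mul_sqrt _ _ _
    _ = hsNorm L * ‖v‖ := by
        have := b.sum_sq_norm_inner_right v
        simp only [Real.norm_eq_abs] at this
        rw [this, Real.sqrt_sq (norm_nonneg v)]
        rfl

theorem hsNorm_le (L : V →ₗ[ℝ] W) {c : ℝ} (hc : ∀ v, ‖L v‖ ≤ c * ‖v‖) :
    hsNorm L ≤ √(Module.finrank ℝ V * c ^ 2) := by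
  refine Real.sqrt_le_sqrt ?_
  calc _ ≤ ∑ i : Fin (Module.finrank ℝ V), c ^ 2 := by
        refine Finset.sum_le_sum fun i _ => pow_le_pow_left₀ (norm_nonneg _) ?_ 2
        simpa using hc (stdOrthonormalBasis ℝ V i)
    _ = _ := by simp

/-- The trace of `B ∘ J = id` is the dimension of `V`. It is also the Hilbert–Schmidt product of `J`
with the adjoint of `B`, so Cauchy–Schwarz applies. -/
theorem finrank_le_hsNorm_mul_hsNorm [FiniteDimensional ℝ W] (J : V →ₗ[ℝ] W) (B : W →ₗ[ℝ] V)
    (hBJ : ∀ v, B (J v) = v) : (Module.finrank ℝ V : ℝ) ≤ hsNorm J * hsNorm B := by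
  set e := stdOrthonormalBasis ℝ V with he
  set u := stdOrthonormalBasis ℝ W with hu
  have h1 : ∀ i, (1 : ℝ) = ∑ k, inner ℝ (u k) (J (e i)) * inner ℝ (e i) (B (u k)) := by
    intro i
    have h2 : ∑ k, inner ℝ (u k) (J (e i)) • B (u k) = e i := by
      conv_rhs => rw [← hBJ (e i), ← u.sum_repr' (J (e i))]
      simp
    calc (1 : ℝ) = inner ℝ (e i) (e i) := by simp
      _ = inner ℝ (e i) (∑ k, inner ℝ (u k) (J (e i)) • B (u k)) := by rw [h2]
      _ = _ := by rw [inner_sum]; simp [inner_smul_right]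
  have h3 : ∑ p : Fin (Module.finrank ℝ V) × Fin (Module.finrank ℝ W),
      inner ℝ (u p.2) (J (e p.1)) ^ 2 = ∑ i, ‖J (e i)‖ ^ 2 := by
    rw [Fintype.sum_prod_type]
    exact Finset.sum_congr rfl fun i _ => by
      simpa using u.sum_sq_norm_inner_right (J (e i))
  have h4 : ∑ p : Fin (Module.finrank ℝ V) × Fin (Module.finrank ℝ W),
      inner ℝ (e p.1) (B (u p.2)) ^ 2 = ∑ k, ‖B (u k)‖ ^ 2 := by
    rw [Fintype.sum_prod_type_right]
    exact Finset.sum_congr rfl fun i _ => by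
      simpa using e.sum_sq_norm_inner_right (B (u i))
  calc (Module.finrank ℝ V : ℝ) = ∑ i : Fin (Module.finrank ℝ V), (1 : ℝ) := by simp
    _ = ∑ p : Fin (Module.finrank ℝ V) × Fin (Module.finrank ℝ W),
        inner ℝ (u p.2) (J (e p.1)) * inner ℝ (e p.1) (B (u p.2)) := by
        rw [Fintype.sum_prod_type]
        exact Finset.sum_congr rfl fun i _ => h1 i
    _ ≤ _ := Real.sum_mul_le_sqrt_mul_sqrt _ _ _
    _ = hsNorm J * hsNorm B := by rw [h3, h4]; rfl

theorem hsNorm_codRestrict_range (J : V →ₗ[ℝ] W) : hsNorm J.rangeRestrict = hsNorm J := rfl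

end

/-! ### Jacobians and the shape constant -/

theorem uniqueDiffOn_refSimplex (d : ℕ) : UniqueDiffOn ℝ (refSimplex d) := by
  -- The barycentre is an interior point.
  refine uniqueDiffOn_convex (convex_refSimplex d)
    ⟨WithLp.toLp 2 fun _ => ((d : ℝ) + 1)⁻¹, mem_interior.2
      ⟨{x | (∀ i, 0 < x i) ∧ ∑ i, x i < 1}, fun x hx => ⟨fun i => (hx.1 i).le, hx.2.le⟩, ?_, ?_⟩⟩
  · rw [ofPred_and]
    refine IsOpen.inter ?_ (isOpen_lt (by fun_prop) continuous_const)
    rw [ofPred_forall]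
    exact isOpen_iInter_of_finite fun i => isOpen_lt continuous_const (by fun_prop)
  · refine ⟨fun i => by positivity, ?_⟩
    simp only [Finset.sum_const, Finset.card_univ, Fintype.card_fin, nsmul_eq_mul]
    rw [← div_eq_mul_inv, div_lt_one (by positivity)]
    linarith

section

variable {n : ℕ} {M : Type*} [TopologicalSpace M] [ChartedSpace (EuclideanSpace ℝ (Fin n)) M]

theorem SmoothSimplex.invJacobian_jacobian (T : SmoothSimplex n M) (x : refSimplex T.dim)
    (v : EuclideanSpace ℝ (Fin T.dim)) :
    T.invJacobian x ((T.jacobian x).rangeRestrict v) = v :=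
  (LinearEquiv.ofInjective (T.jacobian x) (T.jacobian_injective x)).symm_apply_apply v

variable [IsManifold (𝓡 n) ∞ M] [RiemannianBundle (fun x : M => TangentSpace (𝓡 n) x)]
  [IsContinuousRiemannianBundle (EuclideanSpace ℝ (Fin n)) (fun x : M => TangentSpace (𝓡 n) x)]

theorem SmoothSimplex.continuous_norm_jacobian (T : SmoothSimplex n M) :
    Continuous fun q : refSimplex T.dim × EuclideanSpace ℝ (Fin T.dim) =>
      ‖T.jacobian q.1 q.2‖ := by
  have h1 := T.smooth.continuousOn_tangentMapWithin (by simp)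
    (uniqueMDiffOn_iff_uniqueDiffOn.2 (uniqueDiffOn_refSimplex T.dim))
  have h2 : Continuous fun q : refSimplex T.dim × EuclideanSpace ℝ (Fin T.dim) =>
      (TotalSpace.mk' (EuclideanSpace ℝ (Fin n)) (E := TangentSpace (𝓡 n)) (extendRef T.toFun q.1)
        (T.jacobian q.1 q.2) : TangentBundle (𝓡 n) M) := by
    refine h1.comp_continuous (f := fun q : refSimplex T.dim × EuclideanSpace ℝ (Fin T.dim) =>
      (tangentBundleModelSpaceHomeomorph 𝓘(ℝ, EuclideanSpace ℝ (Fin T.dim))).symm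
        ((q.1 : EuclideanSpace ℝ (Fin T.dim)), q.2)) ?_ ?_
    · exact (Homeomorph.continuous _).comp (by fun_prop)
    · exact fun q => q.1.2
  have h3 := h2.inner_bundle h2
  simp only [real_inner_self_eq_norm_sq] at h3
  simpa [Real.sqrt_sq] using h3.sqrt

/-- Compactness of the product of the reference simplex with the unit sphere: the norm is continuous
and nonzero there. In dimension zero the sphere is empty, hence the separate case. -/
theorem SmoothSimplex.exists_bounds_jacobian (T : SmoothSimplex n M) :
    ∃ a b : ℝ, 0 < a ∧ ∀ (x : refSimplex T.dim) v,
      a * ‖v‖ ≤ ‖T.jacobian x v‖ ∧ ‖T.jacobian x v‖ ≤ b * ‖v‖ := by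
  have hpt : Nonempty (refSimplex T.dim) := ⟨⟨refVertex _ 0, refVertex_mem _ 0⟩⟩
  rcases subsingleton_or_nontrivial (EuclideanSpace ℝ (Fin T.dim)) with h | h
  · refine ⟨1, 0, one_pos, fun x v => ?_⟩
    simp [Subsingleton.elim v 0]
  have hK : IsCompact ((univ : Set (refSimplex T.dim)) ×ˢ
      Metric.sphere (0 : EuclideanSpace ℝ (Fin T.dim)) 1) :=
    isCompact_univ.prod (isCompact_sphere _ _)
  have hne : ((univ : Set (refSimplex T.dim)) ×ˢ
      Metric.sphere (0 : EuclideanSpace ℝ (Fin T.dim)) 1).Nonempty :=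
    univ_nonempty.prod (NormedSpace.sphere_nonempty.2 zero_le_one)
  obtain ⟨p, hp, hpmin⟩ := hK.exists_isMinOn hne T.continuous_norm_jacobian.continuousOn
  obtain ⟨q, -, hqmax⟩ := hK.exists_isMaxOn hne T.continuous_norm_jacobian.continuousOn
  have hp0 : p.2 ≠ 0 := norm_ne_zero_iff.1 (by rw [mem_sphere_zero_iff_norm.1 hp.2]; simp)
  refine ⟨‖T.jacobian p.1 p.2‖, ‖T.jacobian q.1 q.2‖, ?_, fun x v => ?_⟩
  · rw [norm_pos_iff]
    exact fun h0 => hp0 (T.jacobian_injective p.1 (by rw [h0, map_zero]))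
  · rcases eq_or_ne v 0 with rfl | hv
    · simp
    have hv' : 0 < ‖v‖ := norm_pos_iff.2 hv
    have hmem : (x, ‖v‖⁻¹ • v) ∈ (univ : Set (refSimplex T.dim)) ×ˢ
        Metric.sphere (0 : EuclideanSpace ℝ (Fin T.dim)) 1 :=
      ⟨mem_univ _, by simp [norm_smul, hv'.ne']⟩
    have e1 : ‖T.jacobian x (‖v‖⁻¹ • v)‖ = ‖T.jacobian x v‖ / ‖v‖ := by
      rw [map_smul, norm_smul, norm_inv, norm_norm, div_eq_inv_mul]
    have h1 := hpmin hmem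
    have h2 := hqmax hmem
    simp only [mem_ofPred_eq, e1] at h1 h2
    exact ⟨(le_div_iff₀ hv').1 h1, (div_le_iff₀ hv').1 h2⟩

end

section

variable {n : ℕ} {M : Type*} [MetricSpace M] [ChartedSpace (EuclideanSpace ℝ (Fin n)) M]
  [IsManifold (𝓡 n) ∞ M] [RiemannianBundle (fun x : M => TangentSpace (𝓡 n) x)]
  [IsContinuousRiemannianBundle (EuclideanSpace ℝ (Fin n)) (fun x : M => TangentSpace (𝓡 n) x)]
  {𝒯 : SmoothTriangulation n M}

/-- The infimum defining the shape constant satisfies its own constraints. Nonemptiness must be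
shown, since `sInf ∅` is the default value 0; it follows from the compactness bounds on the
Jacobian. -/
theorem SmoothTriangulation.hsNorm_le_simplexShapeConst {T : SmoothSimplex n M}
    (hT : 0 < 𝒯.meshSize T) (x : refSimplex T.dim) :
    hsNorm (T.jacobian x) ≤ 𝒯.simplexShapeConst T * 𝒯.meshSize T ∧
      hsNorm (T.invJacobian x) ≤ 𝒯.simplexShapeConst T * (𝒯.meshSize T)⁻¹ := by
  have hne : {C | ∀ x : refSimplex T.dim, hsNorm (T.jacobian x) ≤ C * 𝒯.meshSize T ∧
      hsNorm (T.invJacobian x) ≤ C * (𝒯.meshSize T)⁻¹}.Nonempty := by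
    obtain ⟨a, b, ha, hab⟩ := T.exists_bounds_jacobian
    refine ⟨max (√(Module.finrank ℝ (EuclideanSpace ℝ (Fin T.dim)) * b ^ 2) / 𝒯.meshSize T)
      (√(T.dim * a⁻¹ ^ 2) / (𝒯.meshSize T)⁻¹), fun x => ⟨?_, ?_⟩⟩
    · rw [← div_le_iff₀ hT]
      refine le_max_of_le_left (div_le_div_of_nonneg_right ?_ hT.le)
      exact hsNorm_le _ fun v => (hab x v).2
    · rw [← div_le_iff₀ (inv_pos.2 hT)]
      refine le_max_of_le_right (div_le_div_of_nonneg_right ?_ (inv_pos.2 hT).le)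
      have hd : Module.finrank ℝ (LinearMap.range (T.jacobian x)) = T.dim := by
        rw [LinearMap.finrank_range_of_inj (T.jacobian_injective x)]
        simp
      refine (hsNorm_le (c := a⁻¹) _ ?_).trans_eq (by rw [hd])
      rintro ⟨_, v, rfl⟩
      have h2 := T.invJacobian_jacobian x v
      have h3 : (⟨T.jacobian x v, v, rfl⟩ : LinearMap.range (T.jacobian x)) =
        (T.jacobian x).rangeRestrict v := rfl
      rw [h3, h2, inv_mul_eq_div, le_div_iff₀' ha]
      exact (hab x v).1
  constructor
  · rw [← div_le_iff₀ hT]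
    exact le_csInf hne fun C hC => (div_le_iff₀ hT).2 (hC x).1
  · rw [← div_le_iff₀ (inv_pos.2 hT)]
    exact le_csInf hne fun C hC => (div_le_iff₀ (inv_pos.2 hT)).2 (hC x).2

theorem SmoothTriangulation.hsNorm_le_shapeConst (hb : BddAbove 𝒯.shapeConsts)
    {T : SmoothSimplex n M} (hT𝒯 : T ∈ 𝒯.simplices) (hT : 0 < 𝒯.meshSize T)
    (x : refSimplex T.dim) :
    hsNorm (T.jacobian x) ≤ 𝒯.shapeConst * 𝒯.meshSize T ∧
      hsNorm (T.invJacobian x) ≤ 𝒯.shapeConst * (𝒯.meshSize T)⁻¹ := by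
  have h1 := SmoothTriangulation.hsNorm_le_simplexShapeConst hT x
  have h2 : 𝒯.simplexShapeConst T ≤ 𝒯.shapeConst := le_csSup hb (mem_image_of_mem _ hT𝒯)
  exact ⟨h1.1.trans (mul_le_mul_of_nonneg_right h2 hT.le),
    h1.2.trans (mul_le_mul_of_nonneg_right h2 (inv_pos.2 hT).le)⟩

theorem SmoothTriangulation.dim_le_shapeConst_sq (hb : BddAbove 𝒯.shapeConsts)
    {T : SmoothSimplex n M} (hT𝒯 : T ∈ 𝒯.simplices) (hT : 0 < 𝒯.meshSize T) :
    0 ≤ 𝒯.shapeConst ∧ (T.dim : ℝ) ≤ 𝒯.shapeConst ^ 2 := by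
  let x : refSimplex T.dim := ⟨refVertex _ 0, refVertex_mem _ 0⟩
  have h1 := SmoothTriangulation.hsNorm_le_shapeConst hb hT𝒯 hT x
  have h0 : 0 ≤ 𝒯.shapeConst := nonneg_of_mul_nonneg_left
    ((hsNorm_nonneg _).trans h1.1) hT
  refine ⟨h0, ?_⟩
  have h2 := finrank_le_hsNorm_mul_hsNorm (T.jacobian x).rangeRestrict (T.invJacobian x)
    (T.invJacobian_jacobian x)
  rw [hsNorm_codRestrict_range, finrank_euclideanSpace_fin] at h2
  calc (T.dim : ℝ) ≤ _ := h2
    _ ≤ (𝒯.shapeConst * 𝒯.meshSize T) * (𝒯.shapeConst * (𝒯.meshSize T)⁻¹) :=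
      mul_le_mul h1.1 h1.2 (hsNorm_nonneg _) (mul_nonneg h0 hT.le)
    _ = 𝒯.shapeConst ^ 2 := by field_simp

/-- The gradient bound for the interpolant on a simplex. -/
theorem SmoothTriangulation.abs_interpolant_sub_le (hb : BddAbove 𝒯.shapeConsts) {C : ℝ}
    (hC0 : 0 < C) (hC : ∀ T ∈ 𝒯.simplices, ∀ S : SmoothSimplex n M, S.IsSubsimplex T →
      𝒯.meshSize T ≤ C * 𝒯.meshSize S) {T : SmoothSimplex n M}
    (hT𝒯 : T ∈ 𝒯.simplices) (hT : 0 < 𝒯.meshSize T) (x y : EuclideanSpace ℝ (Fin T.dim))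
    (z : refSimplex T.dim) :
    |𝒯.interpolant T x - 𝒯.interpolant T y| ≤
      𝒯.shapeConst ^ 2 * (1 - 1 / C) * ‖T.jacobian z (x - y)‖ := by
  have hmem : ∀ j, 𝒯.pointMesh (T.vertexPoint j) ∈ Icc (𝒯.meshSize T / C) (𝒯.meshSize T) :=
    fun j => ⟨(div_le_iff₀' hC0).2 (SmoothTriangulation.meshSize_le_mul_pointMesh hC hT𝒯 j),
      𝒯.pointMesh_vertexPoint_le hT𝒯 j⟩
  have hosc : ∀ i j, |𝒯.pointMesh (T.vertexPoint i) - 𝒯.pointMesh (T.vertexPoint j)| ≤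
      𝒯.meshSize T * (1 - 1 / C) := by
    intro i j
    have := abs_sub_le_of_le_of_le (hmem i).1 (hmem i).2 (hmem j).1 (hmem j).2
    rwa [mul_sub, mul_one, mul_one_div]
  have hδ : 0 ≤ 𝒯.meshSize T * (1 - 1 / C) := (abs_nonneg _).trans (hosc 0 0)
  -- Vertex 0 has coordinate `1 - ∑ i, x i`, so the partial derivatives are differences with the
  -- value at vertex 0.
  have hlin : 𝒯.interpolant T x - 𝒯.interpolant T y = ∑ i : Fin T.dim, (x i - y i) *
      (𝒯.pointMesh (T.vertexPoint i.succ) - 𝒯.pointMesh (T.vertexPoint 0)) := by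
    simp only [SmoothTriangulation.interpolant, Fin.sum_univ_succ, baryCoord, Fin.cons_zero,
      Fin.cons_succ, sub_mul, mul_sub, Finset.sum_sub_distrib, Finset.sum_mul]
    ring
  obtain ⟨hS0, hS⟩ := SmoothTriangulation.dim_le_shapeConst_sq hb hT𝒯 hT
  -- Source of the second factor `shapeConst`; the first is the bound on the inverse Jacobian.
  have hsqrt : √(T.dim : ℝ) ≤ 𝒯.shapeConst := Real.sqrt_le_iff.2 ⟨hS0, hS⟩
  have hinv : ‖x - y‖ ≤ 𝒯.shapeConst * (𝒯.meshSize T)⁻¹ * ‖T.jacobian z (x - y)‖ := by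
    have h1 := norm_apply_le_hsNorm (T.invJacobian z) ((T.jacobian z).rangeRestrict (x - y))
    rw [T.invJacobian_jacobian] at h1
    exact h1.trans (mul_le_mul_of_nonneg_right
      (SmoothTriangulation.hsNorm_le_shapeConst hb hT𝒯 hT z).2 (norm_nonneg _))
  rw [hlin]
  calc _ ≤ √(∑ i : Fin T.dim, |x i - y i| ^ 2) * √(∑ i : Fin T.dim,
        |𝒯.pointMesh (T.vertexPoint i.succ) - 𝒯.pointMesh (T.vertexPoint 0)| ^ 2) := by
        refine (Finset.abs_sum_le_sum_abs _ _).trans ?_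
        simp only [abs_mul]
        exact Real.sum_mul_le_sqrt_mul_sqrt _ _ _
    _ ≤ ‖x - y‖ * √(T.dim * (𝒯.meshSize T * (1 - 1 / C)) ^ 2) := by
        refine mul_le_mul (le_of_eq ?_) (Real.sqrt_le_sqrt ?_) (Real.sqrt_nonneg _) (norm_nonneg _)
        · simp [EuclideanSpace.norm_eq]
        · refine (Finset.sum_le_sum fun i _ =>
            pow_le_pow_left₀ (abs_nonneg _) (hosc i.succ 0) 2).trans_eq ?_
          simp
    _ = ‖x - y‖ * (√T.dim * (𝒯.meshSize T * (1 - 1 / C))) := by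
        rw [Real.sqrt_mul (Nat.cast_nonneg _), Real.sqrt_sq hδ]
    _ ≤ (𝒯.shapeConst * (𝒯.meshSize T)⁻¹ * ‖T.jacobian z (x - y)‖) *
        (𝒯.shapeConst * (𝒯.meshSize T * (1 - 1 / C))) :=
        mul_le_mul hinv (mul_le_mul_of_nonneg_right hsqrt hδ) (by positivity) (by positivity)
    _ = _ := by
        field_simp

end

/-! ### The Lipschitz bound for the interpolation on the manifold -/

section

variable {n : ℕ} {M : Type*} [MetricSpace M] [ChartedSpace (EuclideanSpace ℝ (Fin n)) M]
  [IsManifold (𝓡 n) ∞ M] [RiemannianBundle (fun x : M => TangentSpace (𝓡 n) x)]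
  [IsContinuousRiemannianBundle (EuclideanSpace ℝ (Fin n)) (fun x : M => TangentSpace (𝓡 n) x)]
  [IsRiemannianManifold (𝓡 n) M]

/-- In a chart isometric at the base point, the embedding has a derivative with the same norms as
the Jacobian, and the Taylor remainder is absorbed because the Jacobian is bounded below. Comparing
directly with the distance of M avoids any curve inside `T`. -/
theorem SmoothSimplex.eventually_norm_jacobian_le (T : SmoothSimplex n M) (x : refSimplex T.dim)
    {r : ℝ} (hr : 1 < r) :
    ∀ᶠ y : refSimplex T.dim in 𝓝 x, ‖T.jacobian x ((y : EuclideanSpace ℝ (Fin T.dim)) - x)‖ ≤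
      r * dist (T.toFun y) (T.toFun x) := by
  set p : M := extendRef T.toFun (x : EuclideanSpace ℝ (Fin T.dim)) with hp
  have hpx : p = T.toFun x := extendRef_coe _ _
  obtain ⟨s, hs1, hsr⟩ : ∃ s : ℝ, 1 < s ∧ s * s ≤ r := by
    refine ⟨√r, ?_, (Real.mul_self_sqrt (by linarith)).le⟩
    rw [Real.lt_sqrt zero_le_one]
    simpa using hr
  have hs0 : 0 < s := by linarith
  obtain ⟨L, hL, hLr⟩ := exists_almost_isometric_chart (n := n) p
  obtain ⟨U, hU, -, hUL⟩ := hLr s hs1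
  set F : EuclideanSpace ℝ (Fin T.dim) → EuclideanSpace ℝ (Fin n) :=
    fun y => L (extChartAt (𝓡 n) p (extendRef T.toFun y)) with hF
  obtain ⟨D, hD, hDn⟩ : ∃ D : EuclideanSpace ℝ (Fin T.dim) →L[ℝ] EuclideanSpace ℝ (Fin n),
      HasFDerivWithinAt F D (refSimplex T.dim) x ∧ ∀ v, ‖D v‖ = ‖T.jacobian x v‖ := by
    have h1 : HasMFDerivWithinAt 𝓘(ℝ, EuclideanSpace ℝ (Fin T.dim)) 𝓘(ℝ, EuclideanSpace ℝ (Fin n))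
        (extChartAt (𝓡 n) p ∘ extendRef T.toFun) (refSimplex T.dim) x _ :=
      HasMFDerivAt.comp_hasMFDerivWithinAt _
        (mdifferentiableAt_extChartAt (I := 𝓡 n) (mem_chart_source _ p)).hasMFDerivAt
        ((T.smooth x x.2).mdifferentiableWithinAt (by simp)).hasMFDerivWithinAt
    exact ⟨_, L.hasFDerivAt.comp_hasFDerivWithinAt _ h1.hasFDerivWithinAt, fun v => hL _⟩
  obtain ⟨a, b, ha, hab⟩ := T.exists_bounds_jacobian
  -- Chosen so that `‖D v‖ ≤ ‖F y - F x‖ + (ε / a) * ‖D v‖` yields `‖D v‖ ≤ s * ‖F y - F x‖`; the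
  -- chart costs the other factor `s`.
  obtain ⟨ε, hε, hεs⟩ : ∃ ε : ℝ, 0 < ε ∧ s * (ε / a) ≤ s - 1 := by
    refine ⟨(s - 1) * a / s, div_pos (mul_pos (by linarith) ha) hs0, le_of_eq ?_⟩
    field_simp
  have h2 : ∀ᶠ y : refSimplex T.dim in 𝓝 x, ‖F y - F x - D ((y : EuclideanSpace ℝ (Fin T.dim)) - x)‖
      ≤ ε * ‖(y : EuclideanSpace ℝ (Fin T.dim)) - x‖ := by
    have h3 := hD.isLittleO.def hε
    rw [eventually_nhdsWithin_iff] at h3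
    filter_upwards [(continuous_subtype_val.tendsto x).eventually h3] with y hy using hy y.2
  have h4 : ∀ᶠ y : refSimplex T.dim in 𝓝 x, T.toFun y ∈ U :=
    T.continuous_toFun.continuousAt (by rw [← hpx]; exact hU)
  filter_upwards [h2, h4] with y hy hyU
  set v : EuclideanSpace ℝ (Fin T.dim) := (y : EuclideanSpace ℝ (Fin T.dim)) - x
  have h5 : ‖F y - F x‖ ≤ s * dist (T.toFun y) (T.toFun x) := by
    have := (hUL _ hyU _ (mem_of_mem_nhds hU)).1
    rw [hpx] at this
    simpa only [hF, extendRef_coe, hpx] using this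
  have h6 : ‖D v‖ ≤ ‖F y - F x‖ + ε * ‖v‖ := by
    have := norm_sub_le (F y - F x) (F y - F x - D v)
    rw [sub_sub_cancel] at this
    linarith
  have h7 : ε * ‖v‖ ≤ ε / a * ‖D v‖ := by
    rw [div_mul_eq_mul_div, le_div_iff₀ ha, hDn, mul_assoc, mul_comm ‖v‖]
    exact mul_le_mul_of_nonneg_left (hab x v).1 hε.le
  rw [← hDn]
  have h8 : ‖D v‖ ≤ s * ‖F y - F x‖ := by
    have := mul_le_mul_of_nonneg_left (h6.trans (add_le_add_right h7 _)) hs0.le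
    have h9 := mul_le_mul_of_nonneg_right hεs (norm_nonneg (D v))
    linarith
  calc ‖D v‖ ≤ s * ‖F y - F x‖ := h8
    _ ≤ s * (s * dist (T.toFun y) (T.toFun x)) := mul_le_mul_of_nonneg_left h5 hs0.le
    _ = s * s * dist (T.toFun y) (T.toFun x) := by ring
    _ ≤ _ := mul_le_mul_of_nonneg_right hsr dist_nonneg

/-- The piecewise linear interpolation of the mesh size is Lipschitz. -/
theorem SmoothTriangulation.abs_sub_le_of_interpolates {𝒯 : SmoothTriangulation n M} (hn : 0 < n)
    (hb : BddAbove 𝒯.shapeConsts) {C : ℝ} (hC1 : 1 ≤ C)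
    (hC : ∀ T ∈ 𝒯.simplices, ∀ S : SmoothSimplex n M, S.IsSubsimplex T →
      𝒯.meshSize T ≤ C * 𝒯.meshSize S) {f : M → ℝ}
    (hf : ∀ T ∈ 𝒯.simplices, ∀ x : refSimplex T.dim, f (T.toFun x) = 𝒯.interpolant T x)
    (x y : M) : |f x - f y| ≤ 𝒯.shapeConst ^ 2 * (1 - 1 / C) * dist x y := by
  have hL0 : 0 ≤ 𝒯.shapeConst ^ 2 * (1 - 1 / C) := by
    refine mul_nonneg (sq_nonneg _) (sub_nonneg.2 ?_)
    rw [one_div]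
    exact inv_le_one_of_one_le₀ hC1
  set L₀ := 𝒯.shapeConst ^ 2 * (1 - 1 / C) with hL₀
  -- The pointwise estimate holds up to any factor `r > 1`; letting `r` tend to 1 after globalizing
  -- removes it.
  have key : ∀ r : ℝ, 1 < r → |f x - f y| ≤ L₀ * r * dist x y := by
    intro r hr
    refine abs_sub_le_of_eventually (n := n) (by positivity) (fun p => ?_) x y
    have hloc : ∀ T ∈ 𝒯.simplices, T.dim = n → p ∈ T.image →
        ∀ᶠ q in 𝓝 p, q ∈ T.image → |f q - f p| ≤ L₀ * r * dist q p := by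
      rintro T hT hTn ⟨z, rfl⟩
      have hm : 0 < 𝒯.meshSize T := by
        rw [𝒯.meshSize_of_pos (by omega)]
        exact T.diam_pos (by omega)
      have hemb := (T.continuous_toFun.isClosedEmbedding T.injective).isInducing
      have h1 : ∀ᶠ w in 𝓝 z, |f (T.toFun w) - f (T.toFun z)| ≤
          L₀ * r * dist (T.toFun w) (T.toFun z) := by
        filter_upwards [T.eventually_norm_jacobian_le z hr] with w hw
        rw [hf T hT, hf T hT, mul_assoc]
        exact (SmoothTriangulation.abs_interpolant_sub_le hb (by linarith) hC hT hm _ _ z).trans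
          (mul_le_mul_of_nonneg_left hw hL0)
      have h2 : ∀ᶠ q in 𝓝[range T.toFun] (T.toFun z), |f q - f (T.toFun z)| ≤
          L₀ * r * dist q (T.toFun z) := by
        rw [← hemb.map_nhds_eq z]
        exact h1
      exact eventually_nhdsWithin_iff.1 h2
    -- Near `p`, every simplex containing `q` also contains `p`, by local finiteness and closedness.
    -- So the finitely many estimates on the `n`-simplices through `p` cover a neighbourhood.
    have hsub := 𝒯.locallyFinite.eventually_subset
      (fun T => (T : SmoothSimplex n M).isCompact_image.isClosed) p
    have hfin := 𝒯.locallyFinite.point_finite p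
    have hall : ∀ᶠ q in 𝓝 p, ∀ T ∈ {T : 𝒯.simplices | p ∈ (T : SmoothSimplex n M).image},
        (T : SmoothSimplex n M).dim = n → q ∈ (T : SmoothSimplex n M).image →
          |f q - f p| ≤ L₀ * r * dist q p := by
      rw [eventually_all_finite hfin]
      intro T hT
      by_cases hd : (T : SmoothSimplex n M).dim = n
      · filter_upwards [hloc T T.2 hd hT] with q hq _ using hq
      · exact Eventually.of_forall fun q h => absurd h hd
    filter_upwards [hsub, hall] with q hq1 hq2
    obtain ⟨T, hT, hTn, hqT⟩ := 𝒯.cover q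
    exact hq2 ⟨T, hT⟩ (hq1 hqT) hTn hqT
  have hlim : Tendsto (fun r : ℝ => L₀ * r * dist x y) (𝓝[>] 1) (𝓝 (L₀ * 1 * dist x y)) :=
    tendsto_nhdsWithin_of_tendsto_nhds (Continuous.tendsto (by fun_prop) 1)
  rw [mul_one] at hlim
  exact ge_of_tendsto hlim (eventually_nhdsWithin_of_forall fun r hr => key r hr)

end

/-! ### The theorem -/

theorem mainTheorem7 (n : ℕ) (hn : 1 ≤ n)
    (M : Type*) [MetricSpace M] [ChartedSpace (EuclideanSpace ℝ (Fin n)) M]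
    [IsManifold (𝓡 n) ∞ M] [SecondCountableTopology M] [ConnectedSpace M]
    [RiemannianBundle (fun x : M => TangentSpace (𝓡 n) x)]
    [IsContMDiffRiemannianBundle (𝓡 n) ∞ (EuclideanSpace ℝ (Fin n))
      (fun x : M => TangentSpace (𝓡 n) x)]
    [IsRiemannianManifold (𝓡 n) M]
    (𝒯 : SmoothTriangulation n M)
    (hshape : BddAbove 𝒯.shapeConsts)
    (Ctri : ℝ)
    (hCtri : ∀ T ∈ 𝒯.simplices, ∀ S : SmoothSimplex n M, S.IsSubsimplex T →
      𝒯.meshSize T ≤ Ctri * 𝒯.meshSize S) :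
    ∃ h : M → ℝ, ContMDiff (𝓡 n) 𝓘(ℝ, ℝ) ∞ h ∧ (∀ x, 0 < h x) ∧
      (∀ T ∈ 𝒯.simplices, ∀ x ∈ T.image,
        (1.01 * Ctri)⁻¹ * 𝒯.meshSize T ≤ h x ∧ h x ≤ (1.01 * Ctri) * 𝒯.meshSize T) ∧
      (∀ x y : M, x ≠ y →
        |h x - h y| / dist x y ≤ 1.01 * 𝒯.shapeConst ^ 2 * (Ctri - 1 / Ctri)) := by
  have : IsContinuousRiemannianBundle (EuclideanSpace ℝ (Fin n))
      (fun x : M => TangentSpace (𝓡 n) x) := by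
    obtain ⟨g, hg, hgi⟩ := IsContMDiffRiemannianBundle.exists_contMDiff (IB := 𝓡 n) (n := ∞)
      (F := EuclideanSpace ℝ (Fin n)) (E := fun x : M => TangentSpace (𝓡 n) x)
    exact ⟨g, hg.continuous, hgi⟩
  obtain ⟨x₀⟩ := (inferInstance : Nonempty M)
  obtain ⟨T₀, hT₀, hT₀n, -⟩ := 𝒯.cover x₀
  have hC1 : 1 ≤ Ctri := SmoothTriangulation.one_le_of_meshSize_le hCtri hT₀ (by omega)
  have hC0 : 0 < Ctri := by linarith
  obtain ⟨f, hf⟩ := 𝒯.exists_interpolation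
  have hflip := SmoothTriangulation.abs_sub_le_of_interpolates hn hshape hC1 hCtri hf
  have hmesh : ∀ T ∈ 𝒯.simplices, T.dim = n → 0 < 𝒯.meshSize T := fun T _ hTn => by
    rw [𝒯.meshSize_of_pos (by omega)]
    exact T.diam_pos (by omega)
  have hfT : ∀ T ∈ 𝒯.simplices, ∀ x ∈ T.image, 𝒯.meshSize T / Ctri ≤ f x ∧ f x ≤ 𝒯.meshSize T := by
    rintro T hT _ ⟨z, rfl⟩
    rw [hf T hT]
    exact SmoothTriangulation.interpolant_mem_Icc hCtri hC0 hT z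
  have hf0 : ∀ x, 0 < f x := by
    intro x
    obtain ⟨T, hT, hTn, hx⟩ := 𝒯.cover x
    exact (div_pos (hmesh T hT hTn) hC0).trans_le (hfT T hT x hx).1
  have hinv : 1 / Ctri ≤ 1 := by rw [div_le_one hC0]; exact hC1
  -- Ensures that for `Ctri > 1` the target Lipschitz constant strictly exceeds that of `f`.
  have hS : 1 ≤ 𝒯.shapeConst ^ 2 := by
    have h1 := (SmoothTriangulation.dim_le_shapeConst_sq hshape hT₀ (hmesh T₀ hT₀ hT₀n)).2
    rw [hT₀n] at h1
    exact le_trans (by exact_mod_cast hn) h1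
  have hcont : Continuous f := by
    have hL : LipschitzWith (Real.toNNReal (𝒯.shapeConst ^ 2 * (1 - 1 / Ctri))) f :=
      LipschitzWith.of_dist_le_mul fun x y => by
        rw [Real.coe_toNNReal _ (mul_nonneg (sq_nonneg _) (by linarith))]
        exact hflip x y
    exact hL.continuous
  -- The relative error 0.009 fits both sides: 1 - 0.009 ≥ 1/1.01 and 1 + 0.009 ≤ 1.01.
  obtain ⟨h, hsm, happ, hlip⟩ : ∃ h : M → ℝ, ContMDiff (𝓡 n) 𝓘(ℝ, ℝ) ∞ h ∧
      (∀ x, |h x - f x| ≤ 0.009 * f x) ∧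
      ∀ x y, |h x - h y| ≤ 1.01 * 𝒯.shapeConst ^ 2 * (Ctri - 1 / Ctri) * dist x y := by
    -- For `Ctri = 1` both Lipschitz constants vanish, leaving no room for smoothing, but then `f`
    -- is constant.
    rcases hC1.eq_or_lt with h1 | h1
    · subst h1
      have hconst : f = fun _ => f x₀ := by
        ext x
        have := hflip x x₀
        simp only [div_one, sub_self, mul_zero, zero_mul] at this
        exact sub_eq_zero.1 (abs_nonpos_iff.1 this)
      refine ⟨f, ?_, fun x => ?_, fun x y => ?_⟩
      · rw [hconst]
        exact contMDiff_const
      · rw [sub_self, abs_zero]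
        linarith [hf0 x]
      · simpa using hflip x y
    · refine exists_contMDiff_lipschitz_near (η := fun x => 0.009 * f x)
        (mul_nonneg (sq_nonneg _) (by linarith)) ?_ hflip (by fun_prop)
        (fun x => by linarith [hf0 x])
      have h2 : 1 / Ctri < 1 := by rw [div_lt_one hC0]; exact h1
      nlinarith
  have hpos : ∀ x, 0 < h x := fun x => by
    have := abs_le.1 (happ x)
    linarith [this.1, hf0 x]
  refine ⟨h, hsm, hpos, fun T hT x hx => ?_, fun x y hxy => ?_⟩
  · obtain ⟨h1, h2⟩ := hfT T hT x hx
    obtain ⟨h3, h4⟩ := abs_le.1 (happ x)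
    constructor
    · rw [mul_inv, mul_assoc, inv_mul_eq_div Ctri]
      norm_num at h3 ⊢
      linarith [hf0 x]
    · have h5 : 𝒯.meshSize T ≤ Ctri * 𝒯.meshSize T := by
        have := (hf0 x).trans_le h2
        nlinarith
      norm_num at h4 ⊢
      linarith [hf0 x]
  · rw [div_le_iff₀ (dist_pos.2 hxy)]
    exact hlip x y
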